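/- **Setting.** Let $Ap$ be a finite set. LTL formulae over $Ap$ are given by $\varphi ::= \mathbf{tt}\mid\mathbf{ff}\mid a\mid\neg a\mid\varphi\wedge\varphi\mid\varphi\vee\varphi\mid \mathbf X\varphi\mid\mathbf F\varphi\mid\mathbf G\varphi\mid\varphi\,\mathbf U\,\varphi$ ($a\in Ap$), with the usual semantics $w\models\varphi$ on words $w\in(2^{Ap})^\omega$, and $\mathsf L(\varphi)=\{w: w\models\varphi\}$. We write $\models_p$ for propositional implication, where the formulae $a$, $\mathbf X\psi$, $\mathbf F\psi$, $\mathbf G\psi$, $\psi\,\mathbf U\,\chi$ are treated as propositional atoms (and $\neg a$ as the negation of $a$). All states below are formulae up to propositional equivalence. $\mathbb G(\varphi)$ is the set of subformulae of $\varphi$ of the form $\mathbf G\psi$. For $\nu\in 2^{Ap}$ define $af(\mathbf{tt},\nu)=\mathbf{tt}$, $af(\mathbf{ff},\nu)=\mathbf{ff}$; $af(a,\nu)=\mathbf{tt}$ if $a\in\nu$ and $\mathbf{ff}$ otherwise; $af(\neg a,\nu)=\mathbf{ff}$ if $a\in\nu$ and $\mathbf{tt}$ otherwise; $af(\cdot,\nu)$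 commutes with $\wedge$ and $\vee$; $af(\mathbf X\varphi,\nu)=\varphi$; $af(\mathbf F\varphi,\nu)=af(\varphi,\nu)\vee\mathbf F\varphi$; $af(\mathbf G\varphi,\nu)=af(\varphi,\nu)\wedge\mathbf G\varphi$; $af(\varphi\,\mathbf U\,\psi,\nu)=af(\psi,\nu)\vee(af(\varphi,\nu)\wedge\varphi\,\mathbf U\,\psi)$. The function $af_{\mathbf G}$ is defined in the same way except that $af_{\mathbf G}(\mathbf G\varphi,\nu)=\mathbf G\varphi$. Both extend to finite words letter by letter; $Reach(\varphi)$ and $Reach_{\mathbf G}(\varphi)$ are the (finite) sets of formulae $af(\varphi,u)$, resp. $af_{\mathbf G}(\varphi,u)$, with $u$ a finite word, up to propositional equivalence. **Master.** $\mathcal T(\varphi)=(Reach(\varphi),\varphi,af)$. **Slaves.** For $\mathcal G\subseteq\mathbb G(\varphi)$ and $\mathbf G\psi\in\mathbb G(\varphi)$ let $\mathcal M(\psi,\mathcal G)=(Q,i,\delta,F)$ with $Q=Reach_{\mathbf G}(\psi)$, $i=\psi$, $\delta=af_{\mathbf G}$, and $F$ the set of $q\in Q$ with $\bigwedge_{\chi\in\mathcal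 G}\chi\models_p q$. A *sink* is a state $q\ne i$ with $\delta(q,\nu)=q$ for all $\nu$; $S$ is the set of sinks. A *ranking* is a partial function $r:Q\rightharpoonup\{1,\dots,|Q|\}$ that is injective on its domain, is defined at $i$, is undefined on sinks, and whose set of values is downward closed in $\{1,2,\dots\}$. A smaller rank is called older. The Rabin automaton $\mathcal R(\psi,\mathcal G)$ has the rankings as states; its initial state is the ranking defined only at $i$, with $r(i)=1$. On reading $\nu$ in $r$: each ranked state's token moves along $\delta(\cdot,\nu)$; tokens in sinks are dropped; a state holding several tokens keeps only the one of oldest rank; if no token is on $i$, a new, youngest token is put there; finally the ranks are renumbered $1,2,\dots$ preserving their order. Its Rabin pairs are $P_j=(\mathit{fail}\cup\mathit{buy}(j),\ \mathit{succeed}(j))$ for $1\le j\le|Q|$ (the first set of transitions is to be taken finitely often and the second infinitely often), where a transition $r\xrightarrow{\nu}r'$ belongs to * $\mathit{fail}$ iff $\delta(q,\nu)\in S\setminus F$ for some ranked $q$; * $\mathit{succeed}(j)$ iff the token of rank $j$ reaches an accepting state: there is $q$ with $r(q)=j$, $\delta(q,\nu)\in F$, and $q\notin F$ or $q=i$; *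 $\mathit{buy}(j)$ iff there is $q$ with $r(q)<j$ and $\delta(q,\nu)\notin F$ such that $\delta(q,\nu)=i$ or $\delta(q,\nu)=\delta(q',\nu)$ for some ranked $q'\neq q$. The transition system of $\mathcal R(\psi,\mathcal G)$ does not depend on $\mathcal G$. **The automaton.** $\mathcal A(\varphi)$ is the generalized deterministic Rabin automaton whose transition system is the product of $\mathcal T(\varphi)$ with the transition systems of the slaves $\mathcal R(\psi,\mathcal G)$ for all $\mathbf G\psi\in\mathbb G(\varphi)$. Its states are tuples $(\varphi',(r_\psi)_{\mathbf G\psi\in\mathbb G(\varphi)})$. Its acceptance condition is the disjunction, over all $\mathcal G\subseteq\mathbb G(\varphi)$ and all maps $\pi$ assigning to each $\psi$ with $\mathbf G\psi\in\mathcal G$ a rank $\pi(\psi)\in\{1,\dots,|Reach_{\mathbf G}(\psi)|\}$, of the conjunction of the following conditions: * for each $\mathbf G\psi\in\mathcal G$, the run of $\mathcal R(\psi,\mathcal G)$ satisfies the Rabin pair $P_{\pi(\psi)}$; * the run eventually visits only states $(\varphi',(r_\psi))$ such that $$\Big(\bigwedge_{\mathbf G\psi\in\mathcal G}\big(\mathbf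 G\psi\wedge\mathcal F(r_\psi)\big)\ \wedge\bigwedge_{\mathbf G\psi\in\mathbb G(\varphi)\setminus\mathcal G}\neg\mathbf G\psi\Big)\models_p\varphi',$$ where $\mathcal F(r_\psi)$ is the conjunction of the states $q$ with $r_\psi(q)\ge\pi(\psi)$. **Theorem.** For every LTL formula $\varphi$, $\mathsf L(\mathcal A(\varphi))=\mathsf L(\varphi)$. -/

import Mathlib

/-! ## Linear temporal logic in negation normal form -/

/-- LTL formulae over the atomic propositions `Ap`. -/
inductive LTL (Ap : Type*) where
  | tt : LTL Ap
  | ff : LTL Ap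
  | atom (a : Ap) : LTL Ap
  | natom (a : Ap) : LTL Ap
  | and (φ ψ : LTL Ap) : LTL Ap
  | or (φ ψ : LTL Ap) : LTL Ap
  | next (φ : LTL Ap) : LTL Ap
  | fin (φ : LTL Ap) : LTL Ap
  | glob (φ : LTL Ap) : LTL Ap
  | untl (φ ψ : LTL Ap) : LTL Ap

/-- The suffix `w_i = w[i] w[i+1] ⋯` of an infinite word. -/
def wordSuffix {A : Type*} (w : ℕ → A) (i : ℕ) : ℕ → A := fun n => w (i + n)

namespace LTL

variable {Ap : Type*}

/-- `w ⊨ φ`, for an infinite word `w` over the alphabet `2^Ap`. -/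
def Sat : (ℕ → Set Ap) → LTL Ap → Prop
  | _, tt => True
  | _, ff => False
  | w, atom a => a ∈ w 0
  | w, natom a => a ∉ w 0
  | w, and φ ψ => Sat w φ ∧ Sat w ψ
  | w, or φ ψ => Sat w φ ∨ Sat w ψ
  | w, next φ => Sat (wordSuffix w 1) φ
  | w, fin φ => ∃ k, Sat (wordSuffix w k) φ
  | w, glob φ => ∀ k, Sat (wordSuffix w k) φ
  | w, untl φ ψ => ∃ k, Sat (wordSuffix w k) ψ ∧ ∀ j < k, Sat (wordSuffix w j) φ

/-- The models of `φ`. -/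
def language (φ : LTL Ap) : Set (ℕ → Set Ap) := {w | Sat w φ}

/-- The set of subformulae of a formula, the formula itself included. -/
def subformulas : LTL Ap → Set (LTL Ap)
  | tt => {tt}
  | ff => {ff}
  | atom a => {atom a}
  | natom a => {natom a}
  | and φ ψ => {and φ ψ} ∪ (subformulas φ ∪ subformulas ψ)
  | or φ ψ => {or φ ψ} ∪ (subformulas φ ∪ subformulas ψ)
  | next φ => {next φ} ∪ subformulas φ
  | fin φ => {fin φ} ∪ subformulas φ
  | glob φ => {glob φ} ∪ subformulas φ
  | untl φ ψ => {untl φ ψ} ∪ (subformulas φ ∪ subformulas ψ)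

/-- The `G`-subformulae of `φ`: the subformulae of the form `G ψ`. -/
def gSubformulas (φ : LTL Ap) : Set (LTL Ap) := {χ ∈ subformulas φ | ∃ ψ, χ = glob ψ}

/-! ### Propositional implication -/

/-- Truth of a formula under a valuation of the propositional atoms. The atoms are the formulae
`a` (with `¬ a` as the negation of `a`), `X φ`, `F φ`, `G φ` and `φ U ψ`; the values of `v` at
other formulae are not used. -/
def Holds (v : LTL Ap → Prop) : LTL Ap → Prop
  | tt => True
  | ff => False
  | atom a => v (atom a)
  | natom a => ¬ v (atom a)
  | and φ ψ => Holds v φ ∧ Holds v ψ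
  | or φ ψ => Holds v φ ∨ Holds v ψ
  | next φ => v (next φ)
  | fin φ => v (fin φ)
  | glob φ => v (glob φ)
  | untl φ ψ => v (untl φ ψ)

/-- Propositional equivalence. -/
def propEquiv (φ ψ : LTL Ap) : Prop := ∀ v, Holds v φ ↔ Holds v ψ

instance propSetoid (Ap : Type*) : Setoid (LTL Ap) where
  r := propEquiv
  iseqv :=
    ⟨fun _ _ => Iff.rfl, fun h v => (h v).symm, fun h₁ h₂ v => (h₁ v).trans (h₂ v)⟩

/-- Formulae up to propositional equivalence. -/
abbrev PropClass (Ap : Type*) := Quotient (propSetoid Ap)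

/-- Truth of a class of formulae under a propositional valuation. -/
def PropClass.Holds (v : LTL Ap → Prop) (c : PropClass Ap) : Prop :=
  Quotient.lift (LTL.Holds v) (fun φ ψ (h : propEquiv φ ψ) => propext (h v)) c

/-! ### The formulae `af(φ, ν)` and `af_G(φ, ν)` -/

open Classical in
/-- The formula `af(φ, ν)`. -/
noncomputable def af : LTL Ap → Set Ap → LTL Ap
  | tt, _ => tt
  | ff, _ => ff
  | atom a, ν => if a ∈ ν then tt else ff
  | natom a, ν => if a ∈ ν then ff else tt
  | and φ ψ, ν => and (af φ ν) (af ψ ν)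
  | or φ ψ, ν => or (af φ ν) (af ψ ν)
  | next φ, _ => φ
  | fin φ, ν => or (af φ ν) (fin φ)
  | glob φ, ν => and (af φ ν) (glob φ)
  | untl φ ψ, ν => or (af ψ ν) (and (af φ ν) (untl φ ψ))

open Classical in
/-- The formula `af_G(φ, ν)`; it differs from `af(φ, ν)` only in the clause for `G φ`. -/
noncomputable def afG : LTL Ap → Set Ap → LTL Ap
  | tt, _ => tt
  | ff, _ => ff
  | atom a, ν => if a ∈ ν then tt else ff
  | natom a, ν => if a ∈ ν then ff else tt
  | and φ ψ, ν => and (afG φ ν) (afG ψ ν)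
  | or φ ψ, ν => or (afG φ ν) (afG ψ ν)
  | next φ, _ => φ
  | fin φ, ν => or (afG φ ν) (fin φ)
  | glob φ, _ => glob φ
  | untl φ ψ, ν => or (afG ψ ν) (and (afG φ ν) (untl φ ψ))

theorem holds_af (v : LTL Ap → Prop) (φ : LTL Ap) (ν : Set Ap) :
    Holds v (af φ ν) ↔ Holds (fun χ => Holds v (af χ ν)) φ := by
  induction φ with
  | natom a => by_cases h : a ∈ ν <;> simp [af, Holds, h]
  | and φ ψ h₁ h₂ => simp only [af, Holds, h₁, h₂]
  | or φ ψ h₁ h₂ => simp only [af, Holds, h₁, h₂]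
  | _ => simp only [Holds, af]

theorem holds_afG (v : LTL Ap → Prop) (φ : LTL Ap) (ν : Set Ap) :
    Holds v (afG φ ν) ↔ Holds (fun χ => Holds v (afG χ ν)) φ := by
  induction φ with
  | natom a => by_cases h : a ∈ ν <;> simp [afG, Holds, h]
  | and φ ψ h₁ h₂ => simp only [afG, Holds, h₁, h₂]
  | or φ ψ h₁ h₂ => simp only [afG, Holds, h₁, h₂]
  | _ => simp only [Holds, afG]

/-- `af` on formulae up to propositional equivalence. -/
noncomputable def afClass (c : PropClass Ap) (ν : Set Ap) : PropClass Ap :=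
  Quotient.map (fun φ => af φ ν)
    (fun φ ψ h v => by rw [holds_af, holds_af v ψ]; exact h _) c

/-- `af_G` on formulae up to propositional equivalence. -/
noncomputable def afGClass (c : PropClass Ap) (ν : Set Ap) : PropClass Ap :=
  Quotient.map (fun φ => afG φ ν)
    (fun φ ψ h v => by rw [holds_afG, holds_afG v ψ]; exact h _) c

/-- `Reach(φ) = {af(φ, w) | w a finite word}`, up to propositional equivalence. -/
def Reach (φ : LTL Ap) : Set (PropClass Ap) :=
  {c | ∃ w : List (Set Ap), c = w.foldl afClass ⟦φ⟧}

/-- `Reach_G(φ) = {af_G(φ, w) | w a finite word}`, up to propositional equivalence. -/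
def ReachG (φ : LTL Ap) : Set (PropClass Ap) :=
  {c | ∃ w : List (Set Ap), c = w.foldl afGClass ⟦φ⟧}

/-! ### `Reach(φ)` and `Reach_G(φ)` are finite -/

/-- The formula is a positive Boolean combination of elements of `S` (and of `tt`, `ff`). -/
def Generated (S : Set (LTL Ap)) : LTL Ap → Prop
  | tt => True
  | ff => True
  | and φ ψ => Generated S φ ∧ Generated S ψ
  | or φ ψ => Generated S φ ∧ Generated S ψ
  | atom a => atom a ∈ S
  | natom a => natom a ∈ S
  | next φ => next φ ∈ S
  | fin φ => fin φ ∈ S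
  | glob φ => glob φ ∈ S
  | untl φ ψ => untl φ ψ ∈ S

theorem Generated.holds_congr {S : Set (LTL Ap)} {v v' : LTL Ap → Prop}
    (h : ∀ χ ∈ S, Holds v χ ↔ Holds v' χ) {φ : LTL Ap} (hφ : Generated S φ) :
    Holds v φ ↔ Holds v' φ := by
  induction φ with
  | tt => exact Iff.rfl
  | ff => exact Iff.rfl
  | and φ ψ h₁ h₂ => simp only [Holds, h₁ hφ.1, h₂ hφ.2]
  | or φ ψ h₁ h₂ => simp only [Holds, h₁ hφ.1, h₂ hφ.2]
  | _ => exact h _ hφ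

theorem finite_generated {S : Set (LTL Ap)} (hS : S.Finite) :
    {c : PropClass Ap | ∃ φ, Generated S φ ∧ c = ⟦φ⟧}.Finite := by
  have : Finite S := hS
  let f : PropClass Ap → Set (Set S) := fun c =>
    {T | ∃ v : LTL Ap → Prop, T = {χ : S | LTL.Holds v χ} ∧ PropClass.Holds v c}
  refine Set.Finite.of_finite_image (f := f) (Set.toFinite _) ?_
  have key : ∀ φ ψ : LTL Ap, Generated S φ → Generated S ψ → f ⟦φ⟧ = f ⟦ψ⟧ →
      ∀ v, LTL.Holds v φ → LTL.Holds v ψ := by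
    intro φ ψ _ hψ hf v hv
    have hm : {χ : S | LTL.Holds v χ} ∈ f ⟦φ⟧ := ⟨v, rfl, hv⟩
    rw [hf] at hm
    obtain ⟨v', he, hv'⟩ := hm
    refine (hψ.holds_congr (v := v) (v' := v') fun χ hχ => ?_).2 hv'
    have := Set.ext_iff.1 he ⟨χ, hχ⟩
    simpa using this
  rintro _ ⟨φ, hφ, rfl⟩ _ ⟨ψ, hψ, rfl⟩ hf
  exact Quotient.sound fun v => ⟨key φ ψ hφ hψ hf v, key ψ φ hψ hφ hf.symm v⟩

theorem self_mem_subformulas (φ : LTL Ap) : φ ∈ subformulas φ := by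
  cases φ <;> simp [subformulas]

theorem finite_subformulas (φ : LTL Ap) : (subformulas φ).Finite := by
  induction φ <;> simp_all [subformulas]

theorem subformulas_trans {φ ψ : LTL Ap} (h : ψ ∈ subformulas φ) :
    subformulas ψ ⊆ subformulas φ := by
  induction φ with
  | tt => simp_all [subformulas]
  | ff => simp_all [subformulas]
  | atom a => simp_all [subformulas]
  | natom a => simp_all [subformulas]
  | and φ₁ φ₂ h₁ h₂ =>
    rcases h with rfl | h | h
    · exact subset_rfl
    · exact (h₁ h).trans fun x hx => Or.inr (Or.inl hx)
    · exact (h₂ h).trans fun x hx => Or.inr (Or.inr hx)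
  | or φ₁ φ₂ h₁ h₂ =>
    rcases h with rfl | h | h
    · exact subset_rfl
    · exact (h₁ h).trans fun x hx => Or.inr (Or.inl hx)
    · exact (h₂ h).trans fun x hx => Or.inr (Or.inr hx)
  | untl φ₁ φ₂ h₁ h₂ =>
    rcases h with rfl | h | h
    · exact subset_rfl
    · exact (h₁ h).trans fun x hx => Or.inr (Or.inl hx)
    · exact (h₂ h).trans fun x hx => Or.inr (Or.inr hx)
  | next φ h₁ =>
    rcases h with rfl | h
    · exact subset_rfl
    · exact (h₁ h).trans fun x hx => Or.inr hx
  | fin φ h₁ =>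
    rcases h with rfl | h
    · exact subset_rfl
    · exact (h₁ h).trans fun x hx => Or.inr hx
  | glob φ h₁ =>
    rcases h with rfl | h
    · exact subset_rfl
    · exact (h₁ h).trans fun x hx => Or.inr hx

theorem generated_of_subset {φ : LTL Ap} {S : Set (LTL Ap)} (h : subformulas φ ⊆ S) :
    Generated S φ := by
  induction φ with
  | tt => trivial
  | ff => trivial
  | and φ ψ h₁ h₂ =>
    exact ⟨h₁ fun x hx => h (Or.inr (Or.inl hx)), h₂ fun x hx => h (Or.inr (Or.inr hx))⟩
  | or φ ψ h₁ h₂ =>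
    exact ⟨h₁ fun x hx => h (Or.inr (Or.inl hx)), h₂ fun x hx => h (Or.inr (Or.inr hx))⟩
  | _ => exact h (self_mem_subformulas _)

/-- One step of `af` or `af_G` stays within the Boolean combinations of a set that is closed
under subformulae. -/
theorem generated_af {S : Set (LTL Ap)} (hS : ∀ χ ∈ S, subformulas χ ⊆ S) (ν : Set Ap)
    {φ : LTL Ap} (h : Generated S φ) : Generated S (af φ ν) ∧ Generated S (afG φ ν) := by
  have hgen : ∀ χ ∈ S, Generated S χ := fun χ hχ => generated_of_subset (hS χ hχ)
  induction φ with
  | tt => exact ⟨trivial, trivial⟩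
  | ff => exact ⟨trivial, trivial⟩
  | atom a => by_cases ha : a ∈ ν <;> simp [af, afG, ha, Generated]
  | natom a => by_cases ha : a ∈ ν <;> simp [af, afG, ha, Generated]
  | and φ ψ h₁ h₂ =>
    exact ⟨⟨(h₁ h.1).1, (h₂ h.2).1⟩, ⟨(h₁ h.1).2, (h₂ h.2).2⟩⟩
  | or φ ψ h₁ h₂ =>
    exact ⟨⟨(h₁ h.1).1, (h₂ h.2).1⟩, ⟨(h₁ h.1).2, (h₂ h.2).2⟩⟩
  | next φ _ =>
    have := hgen φ (hS _ h (Or.inr (self_mem_subformulas φ)))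
    exact ⟨this, this⟩
  | fin φ h₁ =>
    have h₂ := h₁ (hgen φ (hS _ h (Or.inr (self_mem_subformulas φ))))
    exact ⟨⟨h₂.1, h⟩, ⟨h₂.2, h⟩⟩
  | glob φ h₁ =>
    have h₂ := h₁ (hgen φ (hS _ h (Or.inr (self_mem_subformulas φ))))
    exact ⟨⟨h₂.1, h⟩, h⟩
  | untl φ ψ h₁ h₂ =>
    have h₃ := h₁ (hgen φ (hS _ h (Or.inr (Or.inl (self_mem_subformulas φ)))))
    have h₄ := h₂ (hgen ψ (hS _ h (Or.inr (Or.inr (self_mem_subformulas ψ)))))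
    exact ⟨⟨h₄.1, h₃.1, h⟩, ⟨h₄.2, h₃.2, h⟩⟩

theorem foldl_generated (S : Set (LTL Ap)) (f : LTL Ap → Set Ap → LTL Ap)
    (F : PropClass Ap → Set Ap → PropClass Ap) (hF : ∀ φ ν, F ⟦φ⟧ ν = ⟦f φ ν⟧)
    (hf : ∀ φ ν, Generated S φ → Generated S (f φ ν)) (w : List (Set Ap)) :
    ∀ φ, Generated S φ → ∃ ψ, Generated S ψ ∧ w.foldl F ⟦φ⟧ = ⟦ψ⟧ := by
  induction w with
  | nil => exact fun φ h => ⟨φ, h, rfl⟩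
  | cons ν w ih =>
    intro φ h
    obtain ⟨ψ, hψ, he⟩ := ih _ (hf φ ν h)
    exact ⟨ψ, hψ, by rw [List.foldl_cons, hF, he]⟩

theorem finite_Reach (φ : LTL Ap) : (Reach φ).Finite := by
  refine (finite_generated (finite_subformulas φ)).subset ?_
  rintro _ ⟨w, rfl⟩
  exact foldl_generated _ af afClass (fun _ _ => rfl)
    (fun χ ν h => (generated_af (fun _ h => subformulas_trans h) ν h).1) w φ
    (generated_of_subset subset_rfl)

theorem finite_ReachG (φ : LTL Ap) : (ReachG φ).Finite := by
  refine (finite_generated (finite_subformulas φ)).subset ?_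
  rintro _ ⟨w, rfl⟩
  exact foldl_generated _ afG afGClass (fun _ _ => rfl)
    (fun χ ν h => (generated_af (fun _ h => subformulas_trans h) ν h).2) w φ
    (generated_of_subset subset_rfl)

end LTL

/-! ## Deterministic automata on infinite words -/

/-- A finite deterministic transition system with an initial state, over the alphabet `A`. -/
structure TransSys (A : Type*) where
  State : Type*
  finite : Finite State
  init : State
  step : State → A → State

namespace TransSys

variable {A : Type*}

/-- The state reached after reading `w[0] ⋯ w[n-1]`. -/
def run (T : TransSys A) (w : ℕ → A) : ℕ → T.State
  | 0 => T.init
  | n + 1 => T.step (T.run w n) (w n)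

/-- The `n`-th transition of the run on `w`. -/
def runTrans (T : TransSys A) (w : ℕ → A) (n : ℕ) : T.State × A × T.State :=
  (T.run w n, w n, T.run w (n + 1))

/-- A sink: a state other than the initial one all of whose outgoing transitions are
self-loops. -/
def IsSink (T : TransSys A) (q : T.State) : Prop := q ≠ T.init ∧ ∀ ν, T.step q ν = q

end TransSys

/-- A Rabin pair on transitions (triples source, letter, target). -/
structure RabinPair (Q A : Type*) where
  /-- the transitions that may occur only finitely often -/
  finOften : Set (Q × A × Q)
  /-- the transitions that have to occur infinitely often -/
  infOften : Set (Q × A × Q)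

/-- The sequence of transitions `ρ` satisfies the Rabin pair. -/
def RabinPair.Accepts {Q A : Type*} (P : RabinPair Q A) (ρ : ℕ → Q × A × Q) : Prop :=
  {n | ρ n ∈ P.finOften}.Finite ∧ {n | ρ n ∈ P.infOften}.Infinite

/-- A deterministic Rabin automaton with the pairs `pair 1, …, pair numPairs`. -/
structure DRA (A : Type*) extends TransSys A where
  numPairs : ℕ
  pair : ℕ → RabinPair State A

/-- A generalized deterministic Rabin automaton: the acceptance condition is a disjunction of
conjunctions of Rabin pairs. -/
structure GDRA (A : Type*) extends TransSys A where
  acc : Set (Set (RabinPair State A))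

/-- The words accepted by a generalized deterministic Rabin automaton. -/
def GDRA.language {A : Type*} (R : GDRA A) : Set (ℕ → A) :=
  {w | ∃ D ∈ R.acc, ∀ P ∈ D, P.Accepts (R.runTrans w)}

/-- A Mojmir automaton: `F` is the set of accepting states, closed under transitions. -/
structure Mojmir (A : Type*) extends TransSys A where
  F : Set State
  closed : ∀ q ∈ F, ∀ ν, step q ν ∈ F

/-! ### Rankings -/

/-- A ranking of the states of `T`: a partial function to the ranks `1, …, |Q|`. -/
structure Ranking {A : Type*} (T : TransSys A) where
  rk : T.State → Option ℕ
  range : ∀ q k, rk q = some k → 1 ≤ k ∧ k ≤ Nat.card T.State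
  init_ranked : ∃ k, rk T.init = some k
  sink_unranked : ∀ q, T.IsSink q → rk q = none
  inj : ∀ q q' k, rk q = some k → rk q' = some k → q = q'
  down : ∀ q j, rk q = some j → ∀ k, 1 ≤ k → k ≤ j → ∃ q', rk q' = some k

namespace Ranking

variable {A : Type*} {T : TransSys A}

theorem ext_rk {r s : Ranking T} (h : r.rk = s.rk) : r = s := by
  cases r; cases s; cases h; rfl

theorem finite (T : TransSys A) : Finite (Ranking T) := by
  have := T.finite
  let f : Ranking T → T.State → Option (Fin (Nat.card T.State + 1)) :=
    fun r q => (r.rk q).map (fun k => Fin.ofNat _ k)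
  refine Finite.of_injective f fun r s h => ext_rk (funext fun q => ?_)
  have hq : f r q = f s q := congrFun h q
  simp only [f] at hq
  cases hr : r.rk q with
  | none =>
    cases hs : s.rk q with
    | none => rfl
    | some l => simp [hr, hs] at hq
  | some k =>
    cases hs : s.rk q with
    | none => simp [hr, hs] at hq
    | some l =>
      have h₁ := (r.range q k hr).2
      have h₂ := (s.range q l hs).2
      have h₃ : k % (Nat.card T.State + 1) = l % (Nat.card T.State + 1) := by
        simpa [hr, hs, Fin.ext_iff, Fin.ofNat] using hq
      rw [Nat.mod_eq_of_lt (by omega), Nat.mod_eq_of_lt (by omega)] at h₃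
      rw [h₃]

/-- The non-sink states that hold a token of the configuration `C`. -/
def occupied (T : TransSys A) (C : T.State → Set ℕ) : Set T.State :=
  {q | ¬ T.IsSink q ∧ (C q).Nonempty}

open Classical in
/-- The abstraction of a configuration `C` of tokens: an occupied non-sink state gets the
seniority rank of its oldest (i.e. smallest) token among the oldest tokens of all occupied
non-sink states. -/
noncomputable def abstraction (T : TransSys A) (C : T.State → Set ℕ) (q : T.State) : Option ℕ :=
  if q ∈ occupied T C then some (Nat.card {p // p ∈ occupied T C ∧ sInf (C p) ≤ sInf (C q)})
  else none

theorem abstraction_eq_some {C : T.State → Set ℕ} {q : T.State} {k : ℕ} :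
    abstraction T C q = some k ↔ q ∈ occupied T C ∧
      Nat.card {p // p ∈ occupied T C ∧ sInf (C p) ≤ sInf (C q)} = k := by
  unfold abstraction
  split_ifs with h <;> simp [h]

/-- The abstraction of a configuration that holds a token in the initial state, and in which
no token is in two places, is a ranking. -/
noncomputable def ofConfig (T : TransSys A) (C : T.State → Set ℕ) (hi : (C T.init).Nonempty)
    (hd : ∀ p q x, x ∈ C p → x ∈ C q → p = q) : Ranking T where
  rk := abstraction T C
  range := by
    intro q k h
    obtain ⟨hq, rfl⟩ := abstraction_eq_some.1 h
    have := T.finite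
    exact ⟨Nat.card_pos_iff.2 ⟨⟨⟨q, hq, le_rfl⟩⟩, inferInstance⟩, Finite.card_subtype_le _⟩
  init_ranked := ⟨_, abstraction_eq_some.2 ⟨⟨fun h => h.1 rfl, hi⟩, rfl⟩⟩
  sink_unranked := by
    intro q h
    exact if_neg fun h' => h'.1 h
  inj := by
    have := T.finite
    have key : ∀ q q', q ∈ occupied T C → q' ∈ occupied T C → sInf (C q) ≤ sInf (C q') →
        Nat.card {p // p ∈ occupied T C ∧ sInf (C p) ≤ sInf (C q)} =
          Nat.card {p // p ∈ occupied T C ∧ sInf (C p) ≤ sInf (C q')} → q = q' := by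
      intro q q' hq hq' hle hc
      have hsub : {p | p ∈ occupied T C ∧ sInf (C p) ≤ sInf (C q)} ⊆
          {p | p ∈ occupied T C ∧ sInf (C p) ≤ sInf (C q')} :=
        fun p hp => ⟨hp.1, hp.2.trans hle⟩
      have heq := Set.eq_of_subset_of_ncard_le hsub hc.symm.le (Set.toFinite _)
      have hmem : q' ∈ {p | p ∈ occupied T C ∧ sInf (C p) ≤ sInf (C q)} := by
        rw [heq]; exact ⟨hq', le_rfl⟩
      have hs : sInf (C q) = sInf (C q') := le_antisymm hle hmem.2
      have h₁ := Nat.sInf_mem hq.2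
      rw [hs] at h₁
      exact hd _ _ _ h₁ (Nat.sInf_mem hq'.2)
    intro q q' k h h'
    obtain ⟨hq, hc⟩ := abstraction_eq_some.1 h
    obtain ⟨hq', hc'⟩ := abstraction_eq_some.1 h'
    rcases le_total (sInf (C q)) (sInf (C q')) with hle | hle
    · exact key _ _ hq hq' hle (hc.trans hc'.symm)
    · exact (key _ _ hq' hq hle (hc'.trans hc.symm)).symm
  down := by
    have := T.finite
    have inj : ∀ p q, p ∈ occupied T C → q ∈ occupied T C → sInf (C p) = sInf (C q) → p = q := by
      intro p q hp hq hs
      have h₁ := Nat.sInf_mem hp.2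
      rw [hs] at h₁
      exact hd _ _ _ h₁ (Nat.sInf_mem hq.2)
    suffices H : ∀ d q j, abstraction T C q = some j → ∀ k, 1 ≤ k → k + d = j →
        ∃ q', abstraction T C q' = some k by
      intro q j h k h1 hk
      exact H (j - k) q j h k h1 (by omega)
    intro d
    induction d with
    | zero => intro q j h k _ hk; exact ⟨q, by rw [h]; simp at hk; rw [hk]⟩
    | succ d ih =>
      intro q j h k h1 hk
      obtain ⟨hq, hc⟩ := abstraction_eq_some.1 h
      let B : Set T.State := {p | p ∈ occupied T C ∧ sInf (C p) < sInf (C q)}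
      have hins : {p | p ∈ occupied T C ∧ sInf (C p) ≤ sInf (C q)} = insert q B := by
        ext p
        constructor
        · rintro ⟨hp, hle⟩
          rcases hle.lt_or_eq with hlt | he
          · exact Or.inr ⟨hp, hlt⟩
          · exact Or.inl (inj _ _ hp hq he)
        · rintro (rfl | hp)
          · exact ⟨hq, le_rfl⟩
          · exact ⟨hp.1, hp.2.le⟩
      have hcard : B.ncard + 1 = j := by
        rw [← hc, ← Set.ncard_insert_of_notMem (fun hB : q ∈ B => lt_irrefl _ hB.2)
          (Set.toFinite _), ← hins]
        rfl
      have hne : B.Nonempty := by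
        rw [← Set.ncard_pos (Set.toFinite _)]; omega
      obtain ⟨m, hm, hmax⟩ := Set.exists_max_image B (fun p => sInf (C p)) (Set.toFinite _) hne
      have hB : {p | p ∈ occupied T C ∧ sInf (C p) ≤ sInf (C m)} = B := by
        ext p
        exact ⟨fun hp => ⟨hp.1, hp.2.trans_lt hm.2⟩, fun hp => ⟨hp.1, hmax p hp⟩⟩
      refine ih m B.ncard (abstraction_eq_some.2 ⟨hm.1, ?_⟩) k h1 (by omega)
      rw [← hB]
      rfl

/-- The initial ranking, defined only at the initial state, which has rank `1`
(the abstraction of the configuration with the single token `0`). -/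
noncomputable def initial (T : TransSys A) : Ranking T :=
  ofConfig T (fun q => {x | q = T.init ∧ x = 0}) ⟨0, rfl, rfl⟩
    fun _ _ _ hp hq => hp.1.trans hq.1.symm

/-- The configuration after reading `ν` in the configuration in which each ranked state holds
one token, labelled with its rank: the tokens are moved, and a fresh (youngest) token is put on
the initial state. -/
def move (r : Ranking T) (ν : A) (q' : T.State) : Set ℕ :=
  {k | (∃ q, r.rk q = some k ∧ T.step q ν = q') ∨ (q' = T.init ∧ k = Nat.card T.State + 1)}

/-- The transition function on rankings. -/
noncomputable def step (r : Ranking T) (ν : A) : Ranking T :=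
  ofConfig T (r.move ν) ⟨_, Or.inr ⟨rfl, rfl⟩⟩ <| by
    rintro p q x (⟨p', hp', rfl⟩ | ⟨rfl, rfl⟩) (⟨q', hq', rfl⟩ | ⟨rfl, hx⟩)
    · rw [r.inj _ _ _ hp' hq']
    · have := (r.range _ _ hp').2; omega
    · have := (r.range _ _ hq').2; omega
    · rfl

end Ranking

/-- The transition system of rankings of `T`. -/
noncomputable def TransSys.rankings {A : Type*} (T : TransSys A) : TransSys A where
  State := Ranking T
  finite := Ranking.finite T
  init := Ranking.initial T
  step := Ranking.step

/-! ### The Rabin automaton of a Mojmir automaton -/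

namespace Mojmir

variable {A : Type*} (M : Mojmir A)

/-- Some token is moved into a non-accepting sink. -/
def fail : Set (Ranking M.toTransSys × A × Ranking M.toTransSys) :=
  {t | t.2.2 = t.1.step t.2.1 ∧ ∃ q k, t.1.rk q = some k ∧
    M.IsSink (M.step q t.2.1) ∧ M.step q t.2.1 ∉ M.F}

/-- The token of rank `j` reaches an accepting state: it moves into `F`, and it does so either
from outside `F` or from the state in which tokens are born. -/
def succeed (j : ℕ) : Set (Ranking M.toTransSys × A × Ranking M.toTransSys) :=
  {t | t.2.2 = t.1.step t.2.1 ∧ ∃ q, t.1.rk q = some j ∧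
    (q ∉ M.F ∨ q = M.init) ∧ M.step q t.2.1 ∈ M.F}

/-- A token of rank older than `j` and another token (one that is ranked in the source of the
transition, or the one that is being born) are moved into the same non-accepting state. -/
def buy (j : ℕ) : Set (Ranking M.toTransSys × A × Ranking M.toTransSys) :=
  {t | t.2.2 = t.1.step t.2.1 ∧ ∃ q k, t.1.rk q = some k ∧ k < j ∧ M.step q t.2.1 ∉ M.F ∧
    ((∃ q' k', q' ≠ q ∧ t.1.rk q' = some k' ∧ M.step q t.2.1 = M.step q' t.2.1) ∨
      M.step q t.2.1 = M.init)}

/-- The deterministic Rabin automaton `R(M)`. -/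
noncomputable def toDRA : DRA A where
  toTransSys := M.toTransSys.rankings
  numPairs := Nat.card M.State
  pair j := ⟨M.fail ∪ M.buy j, M.succeed j⟩

end Mojmir

/-! ## The automaton `A(φ)` -/

namespace LTL

variable {Ap : Type*}

/-- The master transition system `T(φ) = (Reach(φ), φ, af)`. -/
noncomputable def master (φ : LTL Ap) : TransSys (Set Ap) where
  State := Reach φ
  finite := finite_Reach φ
  init := ⟨⟦φ⟧, [], rfl⟩
  step q ν := ⟨afClass q.1 ν, by
    obtain ⟨w, hw⟩ := q.2
    exact ⟨w ++ [ν], by rw [List.foldl_append, ← hw]; rfl⟩⟩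

/-- The transition system `(Reach_G(ψ), ψ, af_G)`. -/
noncomputable def slaveSys (ψ : LTL Ap) : TransSys (Set Ap) where
  State := ReachG ψ
  finite := finite_ReachG ψ
  init := ⟨⟦ψ⟧, [], rfl⟩
  step q ν := ⟨afGClass q.1 ν, by
    obtain ⟨w, hw⟩ := q.2
    exact ⟨w ++ [ν], by rw [List.foldl_append, ← hw]; rfl⟩⟩

/-- The Mojmir automaton `M(ψ, 𝒢)`. Its accepting states are those that are propositionally
implied by the conjunction of the `G`-formulae in `𝒢`. -/
noncomputable def mojmir (ψ : LTL Ap) (𝒢 : Set (LTL Ap)) : Mojmir (Set Ap) where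
  toTransSys := slaveSys ψ
  F := {q | ∀ v : LTL Ap → Prop, (∀ χ, glob χ ∈ 𝒢 → v (glob χ)) → PropClass.Holds v q.1}
  closed := by
    rintro ⟨c, hc⟩ hq ν v hv
    have h := hq (fun χ => Holds v (afG χ ν)) (fun χ hχ => hv χ hχ)
    revert h
    clear hq
    dsimp only [slaveSys]
    clear hc
    induction c using Quotient.inductionOn with
    | h χ => exact (holds_afG v χ ν).2

/-- The Rabin automaton `R(ψ, 𝒢)`. Its transition system does not depend on `𝒢`. -/
noncomputable def slave (ψ : LTL Ap) (𝒢 : Set (LTL Ap)) : DRA (Set Ap) := (mojmir ψ 𝒢).toDRA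

/-- The formulae `ψ` such that `G ψ` is a subformula of `φ`. -/
abbrev GIndex (φ : LTL Ap) := {ψ : LTL Ap // glob ψ ∈ gSubformulas φ}

theorem finite_GIndex (φ : LTL Ap) : Finite (GIndex φ) := by
  have : Finite (subformulas φ) := finite_subformulas φ
  refine Finite.of_injective
    (fun ψ : GIndex φ => (⟨glob ψ.1, ψ.2.1⟩ : subformulas φ)) fun a b h => ?_
  have h' : glob a.1 = glob b.1 := congrArg Subtype.val h
  exact Subtype.ext (by injection h')

/-- The transition system of `A(φ)`: the product of the master with the transition systems of
the slaves `R(ψ, 𝒢)` for all `G`-subformulae `G ψ` of `φ`. -/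
noncomputable def productSys (φ : LTL Ap) : TransSys (Set Ap) where
  State := (master φ).State × ((ψ : GIndex φ) → (slaveSys ψ.1).rankings.State)
  finite := by
    have := (master φ).finite
    have := finite_GIndex φ
    have := fun ψ : GIndex φ => (slaveSys ψ.1).rankings.finite
    infer_instance
  init := ((master φ).init, fun ψ => (slaveSys ψ.1).rankings.init)
  step s ν := ((master φ).step s.1 ν, fun ψ => (slaveSys ψ.1).rankings.step (s.2 ψ) ν)

/-- The states of `A(φ)` whose master component `φ'` is propositionally implied by the
conjunction of, for `G ψ ∈ 𝒢`, the formula `G ψ` and the formulae to which the slave for `ψ`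
assigns rank `π ψ` or higher, and, for the other `G`-subformulae `G ψ` of `φ`, the formula
`¬ G ψ`. -/
def goodStates (φ : LTL Ap) (𝒢 : Set (LTL Ap)) (π : GIndex φ → ℕ) : Set (productSys φ).State :=
  {s | ∀ v : LTL Ap → Prop,
    (∀ ψ : GIndex φ, glob ψ.1 ∈ 𝒢 →
      v (glob ψ.1) ∧ ∀ (q : (slaveSys ψ.1).State) (k : ℕ),
        (s.2 ψ).rk q = some k → π ψ ≤ k → PropClass.Holds v q.1) →
    (∀ ψ : GIndex φ, glob ψ.1 ∉ 𝒢 → ¬ v (glob ψ.1)) →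
    PropClass.Holds v s.1.1}

/-- The condition that the run eventually stays within `goodStates φ 𝒢 π`, as a Rabin pair. -/
def masterPair (φ : LTL Ap) (𝒢 : Set (LTL Ap)) (π : GIndex φ → ℕ) :
    RabinPair (productSys φ).State (Set Ap) where
  finOften := {t | t.1 ∉ goodStates φ 𝒢 π}
  infOften := Set.univ

/-- The condition that the slave `R(ψ, 𝒢)` satisfies its `j`-th Rabin pair, as a Rabin pair of
the product. -/
def slavePair (φ : LTL Ap) (𝒢 : Set (LTL Ap)) (ψ : GIndex φ) (j : ℕ) :
    RabinPair (productSys φ).State (Set Ap) where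
  finOften := {t | (t.1.2 ψ, t.2.1, t.2.2.2 ψ) ∈ ((slave ψ.1 𝒢).pair j).finOften}
  infOften := {t | (t.1.2 ψ, t.2.1, t.2.2.2 ψ) ∈ ((slave ψ.1 𝒢).pair j).infOften}

/-- The disjunct of the acceptance condition of `A(φ)` for the guess `(𝒢, π)`. -/
def accDisjunct (φ : LTL Ap) (𝒢 : Set (LTL Ap)) (π : GIndex φ → ℕ) :
    Set (RabinPair (productSys φ).State (Set Ap)) :=
  {masterPair φ 𝒢 π} ∪ {P | ∃ ψ : GIndex φ, glob ψ.1 ∈ 𝒢 ∧ P = slavePair φ 𝒢 ψ (π ψ)}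

/-- The generalized deterministic Rabin automaton `A(φ)`. Only the values of `π` at formulae
`ψ` with `G ψ ∈ 𝒢` matter. -/
noncomputable def automaton (φ : LTL Ap) : GDRA (Set Ap) where
  toTransSys := productSys φ
  acc := {D | ∃ (𝒢 : Set (LTL Ap)) (π : GIndex φ → ℕ), 𝒢 ⊆ gSubformulas φ ∧
    (∀ ψ : GIndex φ, glob ψ.1 ∈ 𝒢 → 1 ≤ π ψ ∧ π ψ ≤ (slave ψ.1 𝒢).numPairs) ∧
    D = accDisjunct φ 𝒢 π}

end LTL

/-! The slave for `ψ` starts a token at every position; at time `t` the token born at `m` sits on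
af_G(`ψ`, w[m..t)). In the relative semantics `SatG 𝒢` a formula `G ψ` is true exactly when it lies
in `𝒢`. By `not_failing_iff` a token reaches an accepting state iff its formula holds in this
semantics on the remaining word. So for `G ψ` in `𝒢` the slave has to check that almost all tokens
succeed.

The rankings do this by counting failing tokens, a number bounded by that of the states. If pair `j`
is satisfied, failing tokens older than `j` are neither lost nor merged, so they settle, and
eventually every token of rank `j` or younger succeeds (`Mojmir.not_failing_of_accepts`).
Conversely, if almost all tokens succeed, the least rank that succeeds infinitely often gives a
satisfied pair, and tokens older than it eventually have succeeded or never will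
(`Mojmir.exists_accepts`).

Soundness: at a late time `t` the valuation `SatG 𝒢` of the remaining word satisfies the premise of
the master condition, so the master state af(`φ`, w[0..t)) holds relative to `𝒢`, hence truly
(`exists_sat_of_satG`), and so does `φ` on `w`.

Completeness: `𝒢` is the set of those `G ψ` that eventually hold on `w`. After some time `N` the
remaining obligation, unfolded by af_G, is eventually implied by `𝒢` (`SatG.exists_holds_unfold`).
The master uses af instead, which also spawns copies of `ψ` for each `G ψ`; the slaves' tokens are
exactly these copies, and `holds_unfold_af` puts them back. -/

/-! ## The transition function on rankings -/

namespace Ranking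

variable {A : Type*} {T : TransSys A}

/-- The labels of the oldest tokens of the occupied states. -/
def labels (T : TransSys A) (C : T.State → Set ℕ) : Set ℕ :=
  (fun p => sInf (C p)) '' occupied T C

/-- Distinct occupied states have distinct oldest tokens, so a rank can be read as the size of a set
of natural numbers, which is easily bounded by an interval. -/
theorem abstraction_eq_ncard {C : T.State → Set ℕ} (hd : ∀ p q x, x ∈ C p → x ∈ C q → p = q)
    {q : T.State} {k : ℕ} (h : abstraction T C q = some k) :
    (labels T C ∩ Set.Iic (sInf (C q))).ncard = k := by
  obtain ⟨-, rfl⟩ := abstraction_eq_some.1 h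
  have : labels T C ∩ Set.Iic (sInf (C q)) =
      (fun p => sInf (C p)) '' {p | p ∈ occupied T C ∧ sInf (C p) ≤ sInf (C q)} := by
    ext x
    constructor
    · rintro ⟨⟨p, hp, rfl⟩, hx⟩
      exact ⟨p, ⟨hp, hx⟩, rfl⟩
    · rintro ⟨p, ⟨hp, hx⟩, rfl⟩
      exact ⟨⟨p, hp, rfl⟩, hx⟩
  rw [this, Set.InjOn.ncard_image]
  · rfl
  · intro p hp p' hp' he
    have h₁ := Nat.sInf_mem hp.1.2
    have h₂ := Nat.sInf_mem hp'.1.2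
    simp only at he
    rw [he] at h₁
    exact hd _ _ _ h₁ h₂

theorem move_disjoint (r : Ranking T) (ν : A) (p q : T.State) (x : ℕ)
    (hp : x ∈ r.move ν p) (hq : x ∈ r.move ν q) : p = q := by
  rcases hp with ⟨p', hp', rfl⟩ | ⟨rfl, rfl⟩ <;> rcases hq with ⟨q', hq', rfl⟩ | ⟨rfl, hx⟩
  · rw [r.inj _ _ _ hp' hq']
  · have := (r.range _ _ hp').2; omega
  · have := (r.range _ _ hq').2; omega
  · rfl

theorem one_le_of_mem_labels {r : Ranking T} {ν : A} {x : ℕ}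
    (h : x ∈ labels T (r.move ν)) : 1 ≤ x := by
  obtain ⟨p, hp, rfl⟩ := h
  rcases Nat.sInf_mem hp.2 with ⟨q, hq, -⟩ | ⟨-, h⟩
  · exact (r.range _ _ hq).1
  · simp only [h]; omega

theorem labels_inter_subset (r : Ranking T) (ν : A) (x : ℕ) :
    labels T (r.move ν) ∩ Set.Iic x ⊆ Set.Icc 1 x :=
  fun _ hy => ⟨one_le_of_mem_labels hy.1, hy.2⟩

theorem sInf_move_le {r : Ranking T} {ν : A} {q : T.State} {k : ℕ} (h : r.rk q = some k) :
    sInf (r.move ν (T.step q ν)) ≤ k :=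
  Nat.sInf_le (Or.inl ⟨q, h, rfl⟩)

/-- A token that does not fall into a sink stays ranked, and does not get younger. -/
theorem step_rk_of_rk {r : Ranking T} {ν : A} {q : T.State} {k : ℕ} (h : r.rk q = some k)
    (hs : ¬ T.IsSink (T.step q ν)) : ∃ k' ≤ k, (r.step ν).rk (T.step q ν) = some k' := by
  refine ⟨_, ?_, abstraction_eq_some.2 ⟨⟨hs, k, Or.inl ⟨q, h, rfl⟩⟩, rfl⟩⟩
  rw [← abstraction_eq_ncard (r.move_disjoint ν)
    (abstraction_eq_some.2 ⟨⟨hs, k, Or.inl ⟨q, h, rfl⟩⟩, rfl⟩)]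
  -- The labels are old ranks and the fresh label, all at least 1, so a new rank never exceeds the
  -- oldest label on its state.
  calc _ ≤ (Set.Icc 1 (sInf (r.move ν (T.step q ν)))).ncard :=
        Set.ncard_le_ncard (labels_inter_subset r ν _) (Set.finite_Icc _ _)
    _ = sInf (r.move ν (T.step q ν)) := by
        rw [← Finset.coe_Icc, Set.ncard_coe_finset, Nat.card_Icc]; omega
    _ ≤ k := sInf_move_le h

theorem rk_of_step_rk {r : Ranking T} {ν : A} {p : T.State} {k : ℕ}
    (h : (r.step ν).rk p = some k) :
    (∃ q k', r.rk q = some k' ∧ T.step q ν = p) ∨ p = T.init := by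
  obtain ⟨⟨-, x, ⟨q, hq, hp⟩ | ⟨hp, -⟩⟩, -⟩ := abstraction_eq_some.1 h
  · exact Or.inl ⟨q, x, hq, hp⟩
  · exact Or.inr hp

/-- If a token keeps its rank, then so do all older tokens. -/
theorem step_rk_eq_of_le {r : Ranking T} {ν : A} {x q : T.State} {K j : ℕ}
    (hx : r.rk x = some K) (hx' : (r.step ν).rk (T.step x ν) = some K) (hq : r.rk q = some j)
    (hj : j ≤ K) : (r.step ν).rk (T.step q ν) = some j := by
  have hcard : ∀ n, (Set.Icc 1 n).ncard = n := fun n => by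
    rw [← Finset.coe_Icc, Set.ncard_coe_finset, Nat.card_Icc]; omega
  -- The new rank `K` counts labels in 1, …, `K`, so all of these are labels: no token of rank at
  -- most `K` was dropped or merged into an older one.
  have hfull : labels T (r.move ν) ∩ Set.Iic K = Set.Icc 1 K := by
    refine Set.eq_of_subset_of_ncard_le (labels_inter_subset r ν K) ?_ (Set.finite_Icc _ _)
    rw [hcard]
    conv_lhs => rw [← abstraction_eq_ncard (r.move_disjoint ν) hx']
    exact Set.ncard_le_ncard
      (Set.inter_subset_inter_right _ (Set.Iic_subset_Iic.2 (sInf_move_le hx)))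
      ((Set.finite_Icc 1 K).subset (labels_inter_subset r ν K))
  have hjK := (r.range _ _ hq)
  have hmem : j ∈ labels T (r.move ν) := by
    have : j ∈ Set.Icc 1 K := ⟨hjK.1, hj⟩
    rw [← hfull] at this
    exact this.1
  obtain ⟨p, hp, hpj⟩ := hmem
  simp only at hpj
  have hjp : j ∈ r.move ν p := hpj ▸ Nat.sInf_mem hp.2
  obtain rfl : p = T.step q ν := r.move_disjoint ν _ _ _ hjp (Or.inl ⟨q, hq, rfl⟩)
  have h : (r.step ν).rk (T.step q ν) = some _ := abstraction_eq_some.2 ⟨hp, rfl⟩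
  rw [h, ← abstraction_eq_ncard (r.move_disjoint ν) h, hpj]
  congr 1
  conv_rhs => rw [← hcard j]
  congr 1
  refine subset_antisymm (labels_inter_subset r ν j) fun y hy => ⟨?_, hy.2⟩
  have : y ∈ Set.Icc 1 K := ⟨hy.1, hy.2.trans hj⟩
  rw [← hfull] at this
  exact this.1

end Ranking

/-! ### Monotone sequences of natural numbers that become constant -/

/-- The infimum over all indices from `N` on is attained, and the sequence cannot move afterwards.
-/
theorem exists_forall_ge_eq_of_succ_le {f : ℕ → ℕ} {N : ℕ} (h : ∀ n ≥ N, f (n + 1) ≤ f n) :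
    ∃ M ≥ N, ∀ n ≥ M, f (n + 1) = f n := by
  have hne : (f '' Set.Ici N).Nonempty := ⟨_, N, Set.self_mem_Ici, rfl⟩
  obtain ⟨M, hM, he⟩ := Nat.sInf_mem hne
  have hle : ∀ n ≥ M, f n ≤ f M := by
    intro n hn
    induction n, hn using Nat.le_induction with
    | base => exact le_rfl
    | succ n hn ih => exact (h n (le_trans hM hn)).trans ih
  have heq : ∀ n ≥ M, f n = f M := fun n hn =>
    le_antisymm (hle n hn) (he ▸ Nat.sInf_le ⟨n, le_trans hM hn, rfl⟩)
  exact ⟨M, hM, fun n hn => by rw [heq n hn, heq (n + 1) (by omega)]⟩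

theorem exists_forall_ge_eq_of_le_succ {f : ℕ → ℕ} {N B : ℕ} (hB : ∀ n, f n ≤ B)
    (h : ∀ n ≥ N, f n ≤ f (n + 1)) : ∃ M ≥ N, ∀ n ≥ M, f (n + 1) = f n := by
  obtain ⟨M, hM, he⟩ := exists_forall_ge_eq_of_succ_le (f := fun n => B - f n) (N := N)
    fun n hn => Nat.sub_le_sub_left (h n hn) _
  refine ⟨M, hM, fun n hn => ?_⟩
  have := he n hn
  have := hB n
  have := hB (n + 1)
  omega

theorem Set.Finite.exists_forall_ge_notMem {S : Set ℕ} (h : S.Finite) :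
    ∃ N, ∀ n ≥ N, n ∉ S := by
  obtain ⟨B, hB⟩ := h.bddAbove
  exact ⟨B + 1, fun n hn hm => by have := hB hm; omega⟩

/-! ## Mojmir automata and their Rabin automata -/

/-- The state reached from `q` by reading `w[m] ⋯ w[m+n-1]`. -/
def TransSys.runFrom {A : Type*} (T : TransSys A) (w : ℕ → A) (q : T.State) (m : ℕ) :
    ℕ → T.State
  | 0 => q
  | n + 1 => T.step (T.runFrom w q m n) (w (m + n))

theorem TransSys.runFrom_succ {A : Type*} (T : TransSys A) (w : ℕ → A) (q : T.State) (m n : ℕ) :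
    T.runFrom w q m (n + 1) = T.runFrom w (T.step q (w m)) (m + 1) n := by
  induction n with
  | zero => rfl
  | succ n ih =>
    rw [runFrom, ih, runFrom]
    congr 2
    omega

theorem TransSys.IsSink.runFrom_eq {A : Type*} {T : TransSys A} {q : T.State} (h : T.IsSink q)
    (w : ℕ → A) (m n : ℕ) : T.runFrom w q m n = q := by
  induction n with
  | zero => rfl
  | succ n ih => rw [runFrom, ih, h.2]

/-- Every ranking ranks the initial state, and a ranked token stays ranked until it falls into a
sink. The rank may belong to an older token with which the one born at `m` has merged. -/
theorem TransSys.exists_rk_runFrom_init {A : Type*} (T : TransSys A) (w : ℕ → A) (m n : ℕ) :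
    T.IsSink (T.runFrom w T.init m n) ∨
      ∃ k, (T.rankings.run w (m + n)).rk (T.runFrom w T.init m n) = some k := by
  induction n with
  | zero => exact Or.inr (Ranking.init_ranked _)
  | succ n ih =>
    by_cases hs : T.IsSink (T.runFrom w T.init m (n + 1))
    · exact Or.inl hs
    · refine Or.inr ?_
      rcases ih with h | ⟨k, hk⟩
      · exact absurd (by rw [TransSys.runFrom, h.2]; exact h) hs
      · obtain ⟨k', -, h⟩ := Ranking.step_rk_of_rk (ν := w (m + n)) hk hs
        exact ⟨k', h⟩

namespace Mojmir

variable {A : Type*} (M : Mojmir A) (w : ℕ → A)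

/-- The run that starts in `q` at time `t` never reaches an accepting state. -/
def Failing (t : ℕ) (q : M.State) : Prop := ∀ n, M.runFrom w q t n ∉ M.F

variable {M w}

theorem Failing.notMem {t : ℕ} {q : M.State} (h : M.Failing w t q) : q ∉ M.F := h 0

theorem Failing.step {t : ℕ} {q : M.State} (h : M.Failing w t q) :
    M.Failing w (t + 1) (M.step q (w t)) := fun n => by
  rw [← TransSys.runFrom_succ]; exact h _

theorem Failing.of_step {t : ℕ} {q : M.State} (h : M.Failing w (t + 1) (M.step q (w t))) :
    M.Failing w t q := by
  rintro (_ | n)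
  · exact fun hq => h.notMem (M.closed _ hq _)
  · rw [TransSys.runFrom_succ]; exact h n

theorem failing_of_isSink {t : ℕ} {q : M.State} (h : M.IsSink q) (hq : q ∉ M.F) :
    M.Failing w t q := fun n => by rwa [h.runFrom_eq]

theorem runFrom_mem {t n n' : ℕ} {q : M.State} (h : M.runFrom w q t n ∈ M.F) (hn : n ≤ n') :
    M.runFrom w q t n' ∈ M.F := by
  induction n', hn using Nat.le_induction with
  | base => exact h
  | succ n' _ ih => exact M.closed _ ih _

variable (M w)

/-- All tokens are born in `M.init` and `F` is closed. This settles the degenerate case behind the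
clause `q = M.init` of `succeed`. -/
theorem mem_of_init_mem (h : M.init ∈ M.F) (t : ℕ) :
    ∀ q k, (M.rankings.run w t).rk q = some k → q ∈ M.F := by
  induction t with
  | zero =>
    intro q k hq
    obtain ⟨⟨-, x, hx, -⟩, -⟩ := Ranking.abstraction_eq_some.1 hq
    rwa [hx]
  | succ t ih =>
    intro q k hq
    rcases Ranking.rk_of_step_rk hq with ⟨q', k', h', rfl⟩ | rfl
    · exact M.closed _ (ih _ _ h') _
    · exact h

/-- If the `j`-th Rabin pair is satisfied, then almost all tokens succeed, and eventually so do
all tokens of rank `j` or younger. -/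
theorem not_failing_of_accepts {j : ℕ}
    (h : (M.toDRA.pair j).Accepts (M.toDRA.runTrans w)) :
    ∃ N, ∀ t ≥ N, ¬ M.Failing w t M.init ∧
      ∀ q k, (M.rankings.run w t).rk q = some k → j ≤ k → ¬ M.Failing w t q := by
  have := M.finite
  obtain ⟨hfin, hinf⟩ := h
  obtain ⟨N₀, hN₀⟩ := hfin.exists_forall_ge_notMem
  have hfail : ∀ t ≥ N₀, ∀ q k, (M.rankings.run w t).rk q = some k →
      M.IsSink (M.step q (w t)) → M.step q (w t) ∈ M.F := by
    intro t ht q k hq hs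
    by_contra hF
    exact hN₀ t ht (Or.inl ⟨rfl, q, k, hq, hs, hF⟩)
  have hbuy : ∀ t ≥ N₀, ∀ q k, (M.rankings.run w t).rk q = some k → k < j →
      M.step q (w t) ∉ M.F → M.step q (w t) ≠ M.init ∧
      ∀ q' k', (M.rankings.run w t).rk q' = some k' → M.step q (w t) = M.step q' (w t) →
        q' = q := by
    intro t ht q k hq hk hF
    refine ⟨fun hi => hN₀ t ht (Or.inr ⟨rfl, q, k, hq, hk, hF, Or.inr hi⟩), ?_⟩
    intro q' k' hq' he
    by_contra hne
    exact hN₀ t ht (Or.inr ⟨rfl, q, k, hq, hk, hF, Or.inl ⟨q', k', hne, hq', he⟩⟩)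
  have hstep : ∀ t ≥ N₀, ∀ q k, (M.rankings.run w t).rk q = some k → M.Failing w t q →
      ∃ k' ≤ k, (M.rankings.run w (t + 1)).rk (M.step q (w t)) = some k' := by
    intro t ht q k hq hf
    exact Ranking.step_rk_of_rk hq fun hs => hf.step.notMem (hfail t ht q k hq hs)
  -- The failing tokens older than `j`. Without `fail` and `buy j` they move injectively and stay in
  -- `S`, so their number grows until each step is a bijection from `S t` to `S (t + 1)`.
  let S : ℕ → Set M.State := fun t =>
    {q | ∃ k < j, (M.rankings.run w t).rk q = some k ∧ M.Failing w t q}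
  have hinj : ∀ t ≥ N₀, Set.InjOn (fun q => M.step q (w t)) (S t) := by
    rintro t ht q ⟨k, hk, hq, hf⟩ q' ⟨k', hk', hq', hf'⟩ he
    exact ((hbuy t ht q k hq hk hf.step.notMem).2 q' k' hq' he).symm
  have hsub : ∀ t ≥ N₀, (fun q => M.step q (w t)) '' S t ⊆ S (t + 1) := by
    rintro t ht _ ⟨q, ⟨k, hk, hq, hf⟩, rfl⟩
    obtain ⟨k', hk', h⟩ := hstep t ht q k hq hf
    exact ⟨k', hk'.trans_lt hk, h, hf.step⟩
  obtain ⟨N₁, hN₁, hcard⟩ := exists_forall_ge_eq_of_le_succ (f := fun t => (S t).ncard)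
    (N := N₀) (B := Nat.card M.State) (fun t => Set.ncard_le_card _) fun t ht => by
      rw [← (hinj t ht).ncard_image]
      exact Set.ncard_le_ncard (hsub t ht) (Set.toFinite _)
  have heq : ∀ t ≥ N₁, (fun q => M.step q (w t)) '' S t = S (t + 1) := by
    intro t ht
    refine Set.eq_of_subset_of_ncard_le (hsub t (hN₁.trans ht)) ?_ (Set.toFinite _)
    rw [(hinj t (hN₁.trans ht)).ncard_image]
    exact (hcard t ht).le
  -- A failing token passing from rank at least `j` to a rank below `j` would land on the image of
  -- some element of `S t`, a merge that `buy j` forbids.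
  have hge : ∀ t ≥ N₁, ∀ q k, (M.rankings.run w t).rk q = some k → M.Failing w t q → j ≤ k →
      ∀ k', (M.rankings.run w (t + 1)).rk (M.step q (w t)) = some k' → j ≤ k' := by
    intro t ht q k hq hf hk k' hk'
    by_contra! hlt
    have hmem : M.step q (w t) ∈ S (t + 1) := ⟨k', hlt, hk', hf.step⟩
    rw [← heq t ht] at hmem
    obtain ⟨p, ⟨l, hl, hp, hpf⟩, he⟩ := hmem
    have := (hbuy t (hN₁.trans ht) p l hp hl hpf.step.notMem).2 q k hq he
    subst this
    rw [hp] at hq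
    injection hq
    omega
  -- The rank of a failing token never increases; by `hge` and the induction hypothesis it cannot
  -- decrease either, so it stays `k` forever.
  have key : ∀ k, ∀ t ≥ N₁, ∀ q, (M.rankings.run w t).rk q = some k → j ≤ k →
      ¬ M.Failing w t q := by
    intro k
    induction k using Nat.strong_induction_on with
    | _ k ih =>
    intro t ht q hq hk hf
    have hconst : ∀ n, (M.rankings.run w (t + n)).rk (M.runFrom w q t n) = some k ∧
        M.Failing w (t + n) (M.runFrom w q t n) := by
      intro n
      induction n with
      | zero => exact ⟨hq, hf⟩
      | succ n ihn =>
        obtain ⟨k', hk', h⟩ := hstep (t + n) (by omega) _ _ ihn.1 ihn.2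
        have hj := hge (t + n) (by omega) _ _ ihn.1 ihn.2 hk k' h
        rcases hk'.lt_or_eq with hlt | rfl
        · exact absurd ihn.2.step (ih k' hlt (t + n + 1) (by omega) _ h hj)
        · exact ⟨h, ihn.2.step⟩
    -- A frozen rank `k` freezes all older ranks, so one and the same token `p` holds rank `j`
    -- forever. Its first success puts it into `F` for good; a second one then has to start at an
    -- accepting `M.init`, which would put every token, also the failing one, into `F`.
    obtain ⟨s₀, ⟨-, q₀, hq₀, -, hF₀⟩, hs₀⟩ := hinf.exists_gt t
    have hj1 := ((M.rankings.run w s₀).range _ _ hq₀).1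
    obtain ⟨p, hp⟩ := (M.rankings.run w t).down _ _ hq j hj1 hk
    have hpath : ∀ n, (M.rankings.run w (t + n)).rk (M.runFrom w p t n) = some j := by
      intro n
      induction n with
      | zero => exact hp
      | succ n ihn => exact Ranking.step_rk_eq_of_le (hconst n).1 (hconst (n + 1)).1 ihn hk
    obtain ⟨s₁, ⟨-, q₁, hq₁, hor, -⟩, hs₁⟩ := hinf.exists_gt s₀
    obtain ⟨a, rfl⟩ := Nat.exists_eq_add_of_le hs₀.le
    obtain ⟨b, rfl⟩ := Nat.exists_eq_add_of_le (hs₀.trans hs₁).le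
    have e₀ : M.runFrom w p t a = q₀ := (M.rankings.run w (t + a)).inj _ _ _ (hpath a) hq₀
    have e₁ : M.runFrom w p t b = q₁ := (M.rankings.run w (t + b)).inj _ _ _ (hpath b) hq₁
    have hFa : M.runFrom w p t (a + 1) ∈ M.F := by
      rw [TransSys.runFrom, e₀]; exact hF₀
    have hFb : q₁ ∈ M.F := e₁ ▸ runFrom_mem hFa (by omega)
    rcases hor with h | h
    · exact h hFb
    · exact hf.notMem (M.mem_of_init_mem w (h ▸ hFb) t q k hq)
  -- The `+ 1` provides a preceding transition: a newborn failing token of rank below `j` would lie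
  -- in the image of `S`, but `buy j` forbids moving an older failing token onto `M.init`.
  refine ⟨N₁ + 1, fun t ht => ⟨fun hf => ?_, fun q k hq hk => key k t (by omega) q hq hk⟩⟩
  obtain ⟨k, hk⟩ := (M.rankings.run w t).init_ranked
  rcases le_or_gt j k with hjk | hjk
  · exact key k t (by omega) _ hk hjk hf
  · obtain ⟨t, rfl⟩ : ∃ s, t = s + 1 := ⟨t - 1, by omega⟩
    have hmem : M.init ∈ S (t + 1) := ⟨k, hjk, hk, hf⟩
    rw [← heq t (by omega)] at hmem
    obtain ⟨p, ⟨l, hl, hp, hpf⟩, he⟩ := hmem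
    exact (hbuy t (by omega) p l hp hl hpf.step.notMem).1 he

/-- If almost all tokens succeed, then some Rabin pair `j` is satisfied such that eventually all
tokens older than rank `j` either have succeeded or never will. -/
theorem exists_accepts {N : ℕ} (h : ∀ t ≥ N, ¬ M.Failing w t M.init) :
    ∃ j, 1 ≤ j ∧ j ≤ M.toDRA.numPairs ∧ (M.toDRA.pair j).Accepts (M.toDRA.runTrans w) ∧
      ∃ T, ∀ t ≥ T, ∀ q k, (M.rankings.run w t).rk q = some k → k < j → q ∉ M.F →
        M.Failing w t q := by
  have := M.finite
  have hsucc : ∀ n, ∃ t ≥ n, ∃ k ∈ Set.Icc 1 (Nat.card M.State),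
      M.toDRA.runTrans w t ∈ M.succeed k := by
    intro n
    -- The index `l + 1` asks for a transition into `F`, so a token born in `F` succeeds with its
    -- first move.
    have hex : ∃ l, M.runFrom w M.init (max n N) (l + 1) ∈ M.F := by
      by_contra! hno
      refine h (max n N) (le_max_right _ _) ?_
      rintro (_ | l)
      · exact fun hi => hno 0 (M.closed _ hi _)
      · exact hno l
    classical
    have hl := Nat.find_spec hex
    have hmin : M.runFrom w M.init (max n N) (Nat.find hex) ∉ M.F ∨
        M.runFrom w M.init (max n N) (Nat.find hex) = M.init := by
      rcases hc : Nat.find hex with _ | l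
      · exact Or.inr rfl
      · exact Or.inl (Nat.find_min hex (m := l) (by omega))
    set l := Nat.find hex
    rcases M.exists_rk_runFrom_init w (max n N) l with hs | ⟨k, hk⟩
    · exfalso
      rcases hmin with hm | hm
      · rw [TransSys.runFrom, hs.2] at hl
        exact hm hl
      · exact hs.1 hm
    · exact ⟨max n N + l, by omega, k, (M.rankings.run w _).range _ _ hk, rfl, _, hk, hmin, hl⟩
  have hexj : ∃ j, {t | M.toDRA.runTrans w t ∈ M.succeed j}.Infinite := by
    by_contra! hall
    have hfin : (⋃ k ∈ Set.Icc 1 (Nat.card M.State),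
        {t | M.toDRA.runTrans w t ∈ M.succeed k}).Finite :=
      (Set.finite_Icc _ _).biUnion fun k _ => Set.not_infinite.1 (by simpa using hall k)
    obtain ⟨n, hn⟩ := hfin.exists_forall_ge_notMem
    obtain ⟨t, ht, k, hk, hs⟩ := hsucc n
    exact hn t ht (Set.mem_biUnion hk hs)
  classical
  -- The least rank is chosen so that all ranks below it succeed only finitely often; after `T` a
  -- token older than `j` outside `F` can no longer enter `F`, as it only gets older.
  have hj := Nat.find_spec hexj
  have hjmin : ∀ k < Nat.find hexj, {t | M.toDRA.runTrans w t ∈ M.succeed k}.Finite :=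
    fun k hk => Set.not_infinite.1 (Nat.find_min hexj hk)
  set j := Nat.find hexj
  obtain ⟨T, hT⟩ := ((Set.finite_Iio j).biUnion hjmin).exists_forall_ge_notMem
  have hstay : ∀ n, ∀ t ≥ T, ∀ q k, (M.rankings.run w t).rk q = some k → k < j → q ∉ M.F →
      M.runFrom w q t n ∉ M.F := by
    intro n
    induction n with
    | zero => exact fun t _ q k _ _ hq => hq
    | succ n ih =>
      intro t ht q k hq hk hF
      have hF' : M.step q (w t) ∉ M.F := fun hF' =>
        hT t ht (Set.mem_biUnion (x := k) hk ⟨rfl, q, hq, Or.inl hF, hF'⟩)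
      rw [TransSys.runFrom_succ]
      by_cases hs : M.IsSink (M.step q (w t))
      · rwa [hs.runFrom_eq]
      · obtain ⟨k', hk', h'⟩ := Ranking.step_rk_of_rk hq hs
        exact ih (t + 1) (by omega) _ k' h' (by omega) hF'
  have hfailing : ∀ t ≥ T, ∀ q k, (M.rankings.run w t).rk q = some k → k < j → q ∉ M.F →
      M.Failing w t q := fun t ht q k hq hk hF n => hstay n t ht q k hq hk hF
  obtain ⟨t₁, -, q₁, hq₁, -⟩ := hj.nonempty
  have hrange := (M.rankings.run w t₁).range _ _ hq₁
  refine ⟨j, hrange.1, hrange.2, ⟨?_, hj⟩, T, hfailing⟩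
  -- All ranked failing tokens. After `N` none are born, so their number falls until each step is a
  -- bijection from `S t` to `S (t + 1)`. Then no failing token can vanish in a sink (`fail`) or
  -- merge with another (`buy j`).
  let S : ℕ → Set M.State := fun t =>
    {q | (∃ k, (M.rankings.run w t).rk q = some k) ∧ M.Failing w t q}
  have hsub : ∀ t ≥ N, S (t + 1) ⊆ (fun q => M.step q (w t)) '' S t := by
    rintro t ht p ⟨⟨k, hk⟩, hf⟩
    rcases Ranking.rk_of_step_rk hk with ⟨q, k', hq, rfl⟩ | rfl
    · exact ⟨q, ⟨⟨k', hq⟩, hf.of_step⟩, rfl⟩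
    · exact absurd hf (h _ (by omega))
  have hle : ∀ t, ((fun q => M.step q (w t)) '' S t).ncard ≤ (S t).ncard :=
    fun t => Set.ncard_image_le (Set.toFinite _)
  obtain ⟨N₁, hN₁, hcard⟩ := exists_forall_ge_eq_of_succ_le (f := fun t => (S t).ncard)
    (N := N) fun t ht => (Set.ncard_le_ncard (hsub t ht) (Set.toFinite _)).trans (hle t)
  refine (Set.finite_Iio (max N₁ T)).subset fun t ht => ?_
  by_contra! hge
  simp only [Set.mem_Iio, not_lt, max_le_iff] at hge
  have hc := hcard t hge.1
  have heq : S (t + 1) = (fun q => M.step q (w t)) '' S t :=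
    Set.eq_of_subset_of_ncard_le (hsub t (hN₁.trans hge.1)) (hc ▸ hle t) (Set.toFinite _)
  rcases ht with ⟨-, q, k, hq, hs, hF⟩ | ⟨-, q, k, hq, hk, hF, hb⟩
  · have hmem : M.step q (w t) ∈ S (t + 1) :=
      heq ▸ ⟨q, ⟨⟨k, hq⟩, (failing_of_isSink hs hF).of_step⟩, rfl⟩
    obtain ⟨⟨k', hk'⟩, -⟩ := hmem
    exact Option.some_ne_none k' (hk'.symm.trans ((M.rankings.run w (t + 1)).sink_unranked _ hs))
  · have hf : M.Failing w t q :=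
      hfailing t hge.2 q k hq hk fun hq => hF (M.closed _ hq _)
    rcases hb with ⟨q', k', hne, hq', he⟩ | hi
    · have hinj : Set.InjOn (fun q => M.step q (w t)) (S t) :=
        Set.injOn_of_ncard_image_eq (by rw [← heq]; exact hc) (Set.toFinite _)
      have hf' : M.Failing w t q' := by
        apply Failing.of_step
        have := hf.step
        rw [← show M.step q (w t) = M.step q' (w t) from he]
        exact this
      exact hne (hinj ⟨⟨k', hq'⟩, hf'⟩ ⟨⟨k, hq⟩, hf⟩ he.symm)
    · have := hf.step
      rw [show M.step q (w t) = M.init from hi] at this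
      exact h (t + 1) (by omega) this

end Mojmir

/-! ## Correctness of `A(φ)` -/

theorem wordSuffix_wordSuffix {A : Type*} (w : ℕ → A) (m n : ℕ) :
    wordSuffix (wordSuffix w m) n = wordSuffix w (m + n) := by
  funext k
  simp [wordSuffix, Nat.add_assoc]

theorem wordSuffix_zero {A : Type*} (w : ℕ → A) : wordSuffix w 0 = w := by
  funext k
  simp [wordSuffix]

namespace LTL

variable {Ap : Type*}

/-! ### Relative semantics, expansion laws and one-step unfolding -/

/-- The semantics in which a formula `G ψ` counts as true if it belongs to `𝒢`, and as false
otherwise. -/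
def SatG (𝒢 : Set (LTL Ap)) : (ℕ → Set Ap) → LTL Ap → Prop
  | _, tt => True
  | _, ff => False
  | w, atom a => a ∈ w 0
  | w, natom a => a ∉ w 0
  | w, and φ ψ => SatG 𝒢 w φ ∧ SatG 𝒢 w ψ
  | w, or φ ψ => SatG 𝒢 w φ ∨ SatG 𝒢 w ψ
  | w, next φ => SatG 𝒢 (wordSuffix w 1) φ
  | w, fin φ => ∃ k, SatG 𝒢 (wordSuffix w k) φ
  | _, glob φ => glob φ ∈ 𝒢
  | w, untl φ ψ => ∃ k, SatG 𝒢 (wordSuffix w k) ψ ∧ ∀ j < k, SatG 𝒢 (wordSuffix w j) φ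

/-- Truth on a word is itself a propositional valuation, so conditions stated with propositional
implication can be evaluated on words. -/
theorem holds_sat (w : ℕ → Set Ap) (φ : LTL Ap) : Holds (Sat w) φ ↔ Sat w φ := by
  induction φ <;> simp_all [Holds, Sat]

theorem holds_satG (𝒢 : Set (LTL Ap)) (w : ℕ → Set Ap) (φ : LTL Ap) :
    Holds (SatG 𝒢 w) φ ↔ SatG 𝒢 w φ := by
  induction φ <;> simp_all [Holds, SatG]

/-- Expansion law of `F`, for an arbitrary predicate so that it serves both `Sat` and `SatG`. -/
theorem exists_wordSuffix_iff {A : Type*} (w : ℕ → A) (P : (ℕ → A) → Prop) :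
    (∃ k, P (wordSuffix w k)) ↔ P w ∨ ∃ k, P (wordSuffix (wordSuffix w 1) k) := by
  simp only [wordSuffix_wordSuffix, Nat.add_comm 1]
  rw [← Nat.or_exists_add_one, wordSuffix_zero]

theorem forall_wordSuffix_iff {A : Type*} (w : ℕ → A) (P : (ℕ → A) → Prop) :
    (∀ k, P (wordSuffix w k)) ↔ P w ∧ ∀ k, P (wordSuffix (wordSuffix w 1) k) := by
  simp only [wordSuffix_wordSuffix, Nat.add_comm 1]
  rw [← Nat.and_forall_add_one, wordSuffix_zero]

theorem until_wordSuffix_iff {A : Type*} (w : ℕ → A) (P Q : (ℕ → A) → Prop) :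
    (∃ k, Q (wordSuffix w k) ∧ ∀ j < k, P (wordSuffix w j)) ↔
      Q w ∨ (P w ∧ ∃ k, Q (wordSuffix (wordSuffix w 1) k) ∧
        ∀ j < k, P (wordSuffix (wordSuffix w 1) j)) := by
  simp only [wordSuffix_wordSuffix, Nat.add_comm 1]
  rw [← Nat.or_exists_add_one]
  simp only [Nat.forall_lt_succ_left, wordSuffix_zero, Nat.not_lt_zero, false_implies,
    implies_true, and_true]
  refine or_congr Iff.rfl ⟨fun ⟨k, h₁, h₂, h₃⟩ => ⟨h₂, k, h₁, h₃⟩,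
    fun ⟨h₂, k, h₁, h₃⟩ => ⟨k, h₁, h₂, h₃⟩⟩

theorem sat_af (w : ℕ → Set Ap) (φ : LTL Ap) :
    Sat (wordSuffix w 1) (af φ (w 0)) ↔ Sat w φ := by
  induction φ with
  | atom a => by_cases h : a ∈ w 0 <;> simp [af, Sat, h]
  | natom a => by_cases h : a ∈ w 0 <;> simp [af, Sat, h]
  | fin φ ih => simp only [af, Sat, ih, exists_wordSuffix_iff w (fun u => Sat u φ)]
  | glob φ ih => simp only [af, Sat, ih, forall_wordSuffix_iff w (fun u => Sat u φ)]
  | untl φ ψ ih₁ ih₂ =>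
    simp only [af, Sat, ih₁, ih₂,
      until_wordSuffix_iff w (fun u => Sat u φ) (fun u => Sat u ψ)]
  | _ => simp_all only [af, Sat]

/-- The relative truth of `G φ` does not depend on the word, which is why `afG` may leave it
unchanged. -/
theorem satG_afG (𝒢 : Set (LTL Ap)) (w : ℕ → Set Ap) (φ : LTL Ap) :
    SatG 𝒢 (wordSuffix w 1) (afG φ (w 0)) ↔ SatG 𝒢 w φ := by
  induction φ with
  | atom a => by_cases h : a ∈ w 0 <;> simp [afG, SatG, h]
  | natom a => by_cases h : a ∈ w 0 <;> simp [afG, SatG, h]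
  | fin φ ih => simp only [afG, SatG, ih, exists_wordSuffix_iff w (fun u => SatG 𝒢 u φ)]
  | untl φ ψ ih₁ ih₂ =>
    simp only [afG, SatG, ih₁, ih₂,
      until_wordSuffix_iff w (fun u => SatG 𝒢 u φ) (fun u => SatG 𝒢 u ψ)]
  | _ => simp_all only [afG, SatG]

/-! ### Unfolding along finite words -/

/-- The formula reached from `φ` by reading `w[m] ⋯ w[m+n-1]`, for `f = af` or `f = af_G`. -/
def unfold (f : LTL Ap → Set Ap → LTL Ap) (w : ℕ → Set Ap) (φ : LTL Ap) (m : ℕ) : ℕ → LTL Ap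
  | 0 => φ
  | n + 1 => f (unfold f w φ m n) (w (m + n))

section unfold

variable (f : LTL Ap → Set Ap → LTL Ap) (w : ℕ → Set Ap)

theorem unfold_add (φ : LTL Ap) (m k n : ℕ) :
    unfold f w φ m (k + n) = unfold f w (unfold f w φ m k) (m + k) n := by
  induction n with
  | zero => rfl
  | succ n ih => rw [← Nat.add_assoc, unfold, ih, unfold, Nat.add_assoc]

theorem unfold_succ (φ : LTL Ap) (m n : ℕ) :
    unfold f w φ m (n + 1) = unfold f w (f φ (w m)) (m + 1) n := by
  rw [Nat.add_comm, unfold_add]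
  rfl

variable {f}

theorem unfold_of_fixed {φ : LTL Ap} (h : ∀ ν, f φ ν = φ) (m n : ℕ) :
    unfold f w φ m n = φ := by
  induction n with
  | zero => rfl
  | succ n ih => rw [unfold, ih, h]

theorem unfold_and (h : ∀ φ ψ ν, f (and φ ψ) ν = and (f φ ν) (f ψ ν)) (φ ψ : LTL Ap)
    (m n : ℕ) : unfold f w (and φ ψ) m n = and (unfold f w φ m n) (unfold f w ψ m n) := by
  induction n with
  | zero => rfl
  | succ n ih => rw [unfold, ih, h]; rfl

theorem unfold_or (h : ∀ φ ψ ν, f (or φ ψ) ν = or (f φ ν) (f ψ ν)) (φ ψ : LTL Ap)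
    (m n : ℕ) : unfold f w (or φ ψ) m n = or (unfold f w φ m n) (unfold f w ψ m n) := by
  induction n with
  | zero => rfl
  | succ n ih => rw [unfold, ih, h]; rfl

theorem unfold_next (h : ∀ φ ν, f (next φ) ν = φ) (φ : LTL Ap) (m n : ℕ) :
    unfold f w (next φ) m (n + 1) = unfold f w φ (m + 1) n := by
  rw [unfold_succ, h]

theorem unfold_fin (hor : ∀ φ ψ ν, f (or φ ψ) ν = or (f φ ν) (f ψ ν))
    (h : ∀ φ ν, f (fin φ) ν = or (f φ ν) (fin φ)) (φ : LTL Ap) (m n : ℕ) :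
    unfold f w (fin φ) m (n + 1) =
      or (unfold f w φ m (n + 1)) (unfold f w (fin φ) (m + 1) n) := by
  rw [unfold_succ, h, unfold_or w hor, unfold_succ f w φ]

theorem unfold_untl (hand : ∀ φ ψ ν, f (and φ ψ) ν = and (f φ ν) (f ψ ν))
    (hor : ∀ φ ψ ν, f (or φ ψ) ν = or (f φ ν) (f ψ ν))
    (h : ∀ φ ψ ν, f (untl φ ψ) ν = or (f ψ ν) (and (f φ ν) (untl φ ψ))) (φ ψ : LTL Ap)
    (m n : ℕ) : unfold f w (untl φ ψ) m (n + 1) =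
      or (unfold f w ψ m (n + 1))
        (and (unfold f w φ m (n + 1)) (unfold f w (untl φ ψ) (m + 1) n)) := by
  rw [unfold_succ, h, unfold_or w hor, unfold_and w hand, unfold_succ f w φ, unfold_succ f w ψ]

theorem unfold_af_glob (φ : LTL Ap) (m n : ℕ) :
    unfold af w (glob φ) m (n + 1) =
      and (unfold af w φ m (n + 1)) (unfold af w (glob φ) (m + 1) n) := by
  rw [unfold_succ, af, unfold_and w (fun _ _ _ => rfl), unfold_succ af w φ]

theorem unfold_afG_glob (φ : LTL Ap) (m n : ℕ) : unfold afG w (glob φ) m n = glob φ :=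
  unfold_of_fixed w (fun _ => rfl) m n

end unfold

theorem sat_unfold (w : ℕ → Set Ap) (φ : LTL Ap) (n : ℕ) :
    Sat (wordSuffix w n) (unfold af w φ 0 n) ↔ Sat w φ := by
  induction n with
  | zero => rw [wordSuffix_zero]; rfl
  | succ n ih =>
    rw [← ih, ← wordSuffix_wordSuffix, ← sat_af (wordSuffix w n), unfold, Nat.zero_add]
    rfl

theorem satG_unfold (𝒢 : Set (LTL Ap)) (w : ℕ → Set Ap) (φ : LTL Ap) (m n : ℕ) :
    SatG 𝒢 (wordSuffix w (m + n)) (unfold afG w φ m n) ↔ SatG 𝒢 (wordSuffix w m) φ := by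
  induction n with
  | zero => rfl
  | succ n ih =>
    rw [← ih, ← Nat.add_assoc, ← wordSuffix_wordSuffix w (m + n),
      ← satG_afG 𝒢 (wordSuffix w (m + n)), unfold]
    rfl

/-- If `φ` holds, with `𝒢` as the set of the true `G`-formulae, then after finitely many steps
of `af_G` it is propositionally implied by `𝒢`. -/
theorem SatG.exists_holds_unfold {𝒢 : Set (LTL Ap)} {w : ℕ → Set Ap} {φ : LTL Ap} :
    ∀ {m : ℕ}, SatG 𝒢 (wordSuffix w m) φ → ∃ n₀, ∀ n ≥ n₀, ∀ v : LTL Ap → Prop,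
      (∀ χ, glob χ ∈ 𝒢 → v (glob χ)) → Holds v (unfold afG w φ m n) := by
  induction φ with
  | tt =>
    refine fun _ => ⟨0, fun n _ v _ => ?_⟩
    rw [unfold_of_fixed w fun _ => rfl]; trivial
  | ff => exact fun h => h.elim
  | atom a =>
    intro m h
    replace h : a ∈ w m := h
    refine ⟨1, fun n hn v _ => ?_⟩
    obtain ⟨n, rfl⟩ : ∃ k, n = k + 1 := ⟨n - 1, by omega⟩
    rw [unfold_succ, afG, if_pos h, unfold_of_fixed w fun _ => rfl]; trivial
  | natom a =>
    intro m h
    replace h : a ∉ w m := h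
    refine ⟨1, fun n hn v _ => ?_⟩
    obtain ⟨n, rfl⟩ : ∃ k, n = k + 1 := ⟨n - 1, by omega⟩
    rw [unfold_succ, afG, if_neg h, unfold_of_fixed w fun _ => rfl]; trivial
  | and φ ψ ih₁ ih₂ =>
    intro m h
    obtain ⟨n₁, h₁⟩ := ih₁ h.1
    obtain ⟨n₂, h₂⟩ := ih₂ h.2
    refine ⟨max n₁ n₂, fun n hn v hv => ?_⟩
    rw [unfold_and w fun _ _ _ => rfl]
    exact ⟨h₁ n (le_of_max_le_left hn) v hv, h₂ n (le_of_max_le_right hn) v hv⟩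
  | or φ ψ ih₁ ih₂ =>
    rintro m (h | h)
    · obtain ⟨n₁, h₁⟩ := ih₁ h
      refine ⟨n₁, fun n hn v hv => ?_⟩
      rw [unfold_or w fun _ _ _ => rfl]
      exact Or.inl (h₁ n hn v hv)
    · obtain ⟨n₁, h₁⟩ := ih₂ h
      refine ⟨n₁, fun n hn v hv => ?_⟩
      rw [unfold_or w fun _ _ _ => rfl]
      exact Or.inr (h₁ n hn v hv)
  | next φ ih =>
    intro m h
    rw [SatG, wordSuffix_wordSuffix] at h
    obtain ⟨n₁, h₁⟩ := ih h
    refine ⟨n₁ + 1, fun n hn v hv => ?_⟩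
    obtain ⟨n, rfl⟩ : ∃ k, n = k + 1 := ⟨n - 1, by omega⟩
    rw [unfold_next w fun _ _ => rfl]
    exact h₁ n (by omega) v hv
  | fin φ ih =>
    rintro m ⟨k, h⟩
    rw [wordSuffix_wordSuffix] at h
    -- Each letter brings the witness of `F φ` one position closer; at 0 the disjunct for `φ` takes
    -- over.
    induction k generalizing m with
    | zero =>
      obtain ⟨n₁, h₁⟩ := ih h
      refine ⟨n₁ + 1, fun n hn v hv => ?_⟩
      obtain ⟨n, rfl⟩ : ∃ k, n = k + 1 := ⟨n - 1, by omega⟩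
      rw [unfold_fin w (fun _ _ _ => rfl) fun _ _ => rfl]
      exact Or.inl (h₁ _ (by omega) v hv)
    | succ k ihk =>
      obtain ⟨n₁, h₁⟩ := ihk (m := m + 1) (by rwa [Nat.add_assoc, Nat.add_comm 1])
      refine ⟨n₁ + 1, fun n hn v hv => ?_⟩
      obtain ⟨n, rfl⟩ : ∃ k, n = k + 1 := ⟨n - 1, by omega⟩
      rw [unfold_fin w (fun _ _ _ => rfl) fun _ _ => rfl]
      exact Or.inr (h₁ _ (by omega) v hv)
  | glob φ _ =>
    intro m h
    refine ⟨0, fun n _ v hv => ?_⟩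
    rw [unfold_afG_glob]
    exact hv φ h
  | untl φ ψ ih₁ ih₂ =>
    rintro m ⟨k, h, h'⟩
    simp only [wordSuffix_wordSuffix] at h h'
    induction k generalizing m with
    | zero =>
      obtain ⟨n₁, h₁⟩ := ih₂ h
      refine ⟨n₁ + 1, fun n hn v hv => ?_⟩
      obtain ⟨n, rfl⟩ : ∃ k, n = k + 1 := ⟨n - 1, by omega⟩
      rw [unfold_untl w (fun _ _ _ => rfl) (fun _ _ _ => rfl) fun _ _ _ => rfl]
      exact Or.inl (h₁ _ (by omega) v hv)
    | succ k ihk =>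
      obtain ⟨n₁, h₁⟩ := ihk (m := m + 1) (by rwa [Nat.add_assoc, Nat.add_comm 1])
        fun j hj => by rw [Nat.add_assoc, Nat.add_comm 1]; exact h' (j + 1) (by omega)
      obtain ⟨n₂, h₂⟩ := ih₁ (h' 0 (by omega))
      refine ⟨max n₁ n₂ + 1, fun n hn v hv => ?_⟩
      obtain ⟨n, rfl⟩ : ∃ k, n = k + 1 := ⟨n - 1, by omega⟩
      rw [unfold_untl w (fun _ _ _ => rfl) (fun _ _ _ => rfl) fun _ _ _ => rfl]
      exact Or.inr ⟨h₂ _ (by omega) v hv, h₁ _ (by omega) v hv⟩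

/-! ### From af_G back to af -/

/-- All `G`-subformulae of `θ` are `G`-subformulae of `φ`. -/
def GSub (φ θ : LTL Ap) : Prop := ∀ ψ, glob ψ ∈ subformulas θ → glob ψ ∈ gSubformulas φ

theorem gSub_self (φ : LTL Ap) : GSub φ φ := fun ψ h => ⟨h, ψ, rfl⟩

/-- The conjunctions and disjunctions built by `af` are not subformulae of `θ`, so only the
`G`-subformulae are tracked. -/
theorem glob_mem_subformulas_af {θ : LTL Ap} {ν : Set Ap} {ψ : LTL Ap}
    (h : glob ψ ∈ subformulas (af θ ν)) : glob ψ ∈ subformulas θ := by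
  induction θ with
  | atom a => by_cases ha : a ∈ ν <;> simp [af, ha, subformulas] at h
  | natom a => by_cases ha : a ∈ ν <;> simp [af, ha, subformulas] at h
  | _ => simp [af, subformulas] at h ⊢ <;> tauto

theorem GSub.unfold {φ θ : LTL Ap} (h : GSub φ θ) (w : ℕ → Set Ap) (m n : ℕ) :
    GSub φ (unfold af w θ m n) := by
  induction n with
  | zero => exact h
  | succ n ih => exact fun ψ hψ => ih ψ (glob_mem_subformulas_af hψ)

theorem GSub.mono {φ θ χ : LTL Ap} (h : GSub φ θ) (hχ : χ ∈ subformulas θ) : GSub φ χ :=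
  fun ψ hψ => h ψ (subformulas_trans hχ hψ)

/-- A valuation that satisfies `af_G(θ, w[m] ⋯ w[t-1])` also satisfies `af(θ, w[m] ⋯ w[t-1])` if
each `G ψ` that is true under the valuation comes with all the obligations that it spawns. -/
theorem holds_unfold_af {φ : LTL Ap} {w : ℕ → Set Ap} {v : LTL Ap → Prop} {N t : ℕ}
    (hv : ∀ ψ, glob ψ ∈ gSubformulas φ → v (glob ψ) →
      ∀ m n, N ≤ m → m + n = t → Holds v (unfold afG w ψ m n))
    {θ : LTL Ap} (hθ : GSub φ θ) : ∀ {m n : ℕ}, N ≤ m → m + n = t →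
      Holds v (unfold afG w θ m n) → Holds v (unfold af w θ m n) := by
  induction θ with
  | tt =>
    intro m n _ _ _
    rw [unfold_of_fixed w fun _ => rfl]; trivial
  | ff =>
    intro m n _ _ h
    rw [unfold_of_fixed w fun _ => rfl] at h; exact h.elim
  | atom a =>
    rintro m (_ | n) _ _ h
    · exact h
    · rw [unfold_succ] at h ⊢
      by_cases ha : a ∈ w m
      · rw [af, if_pos ha, unfold_of_fixed w fun _ => rfl]; trivial
      · rw [afG, if_neg ha, unfold_of_fixed w fun _ => rfl] at h; exact h.elim
  | natom a =>
    rintro m (_ | n) _ _ h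
    · exact h
    · rw [unfold_succ] at h ⊢
      by_cases ha : a ∈ w m
      · rw [afG, if_pos ha, unfold_of_fixed w fun _ => rfl] at h; exact h.elim
      · rw [af, if_neg ha, unfold_of_fixed w fun _ => rfl]; trivial
  | and φ ψ ih₁ ih₂ =>
    intro m n hm hn h
    rw [unfold_and w fun _ _ _ => rfl] at h ⊢
    exact ⟨ih₁ (hθ.mono (Or.inr (Or.inl (self_mem_subformulas _)))) hm hn h.1,
      ih₂ (hθ.mono (Or.inr (Or.inr (self_mem_subformulas _)))) hm hn h.2⟩
  | or φ ψ ih₁ ih₂ =>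
    intro m n hm hn h
    rw [unfold_or w fun _ _ _ => rfl] at h ⊢
    exact h.imp (ih₁ (hθ.mono (Or.inr (Or.inl (self_mem_subformulas _)))) hm hn)
      (ih₂ (hθ.mono (Or.inr (Or.inr (self_mem_subformulas _)))) hm hn)
  | next φ ih =>
    rintro m (_ | n) hm hn h
    · exact h
    · rw [unfold_next w fun _ _ => rfl] at h ⊢
      exact ih (hθ.mono (Or.inr (self_mem_subformulas _))) (by omega) (by omega) h
  | fin φ ih =>
    intro m n
    induction n generalizing m with
    | zero => exact fun _ _ h => h
    | succ n ihn =>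
      intro hm hn h
      rw [unfold_fin w (fun _ _ _ => rfl) fun _ _ => rfl] at h ⊢
      exact h.imp (ih (hθ.mono (Or.inr (self_mem_subformulas _))) hm hn)
        (ihn (by omega) (by omega))
  | glob ψ ih =>
    intro m n hm hn h
    rw [unfold_afG_glob] at h
    -- `af` turns `G ψ` into its conjunction with af(`ψ`, w[m'..t)) for m ≤ m' < t; `hψ` supplies
    -- the af_G version of every conjunct, since `N ≤ m`.
    have hψ := hv ψ (hθ ψ (self_mem_subformulas _)) h
    induction n generalizing m with
    | zero => exact h
    | succ n ihn =>
      rw [unfold_af_glob]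
      exact ⟨ih (hθ.mono (Or.inr (self_mem_subformulas _))) hm hn (hψ m _ hm hn),
        ihn (by omega) (by omega)⟩
  | untl φ ψ ih₁ ih₂ =>
    intro m n
    induction n generalizing m with
    | zero => exact fun _ _ h => h
    | succ n ihn =>
      intro hm hn h
      rw [unfold_untl w (fun _ _ _ => rfl) (fun _ _ _ => rfl) fun _ _ _ => rfl] at h ⊢
      exact h.imp (ih₂ (hθ.mono (Or.inr (Or.inr (self_mem_subformulas _)))) hm hn)
        (And.imp (ih₁ (hθ.mono (Or.inr (Or.inl (self_mem_subformulas _)))) hm hn)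
          (ihn (by omega) (by omega)))

/-! ### The runs of the automata -/

theorem master_run (φ : LTL Ap) (w : ℕ → Set Ap) (t : ℕ) :
    ((master φ).run w t).1 = ⟦unfold af w φ 0 t⟧ := by
  induction t with
  | zero => rfl
  | succ t ih =>
    change afClass ((master φ).run w t).1 (w t) = _
    rw [ih, unfold, Nat.zero_add]
    rfl

theorem productSys_run_fst (φ : LTL Ap) (w : ℕ → Set Ap) (t : ℕ) :
    ((productSys φ).run w t).1 = (master φ).run w t := by
  induction t with
  | zero => rfl
  | succ t ih =>
    change (master φ).step ((productSys φ).run w t).1 (w t) = _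
    rw [ih]
    rfl

theorem productSys_run_snd (φ : LTL Ap) (w : ℕ → Set Ap) (t : ℕ) (ψ : GIndex φ) :
    ((productSys φ).run w t).2 ψ = (slaveSys ψ.1).rankings.run w t := by
  induction t with
  | zero => rfl
  | succ t ih =>
    change (slaveSys ψ.1).rankings.step (((productSys φ).run w t).2 ψ) (w t) = _
    rw [ih]
    rfl

theorem slaveSys_runFrom (ψ : LTL Ap) (w : ℕ → Set Ap) {q : (slaveSys ψ).State} {χ : LTL Ap}
    (hq : q.1 = ⟦χ⟧) (m n : ℕ) :
    ((slaveSys ψ).runFrom w q m n).1 = ⟦unfold afG w χ m n⟧ := by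
  induction n with
  | zero => exact hq
  | succ n ih =>
    change afGClass ((slaveSys ψ).runFrom w q m n).1 (w (m + n)) = _
    rw [ih]
    rfl

theorem mem_mojmir_F {ψ χ : LTL Ap} {𝒢 : Set (LTL Ap)} {q : (slaveSys ψ).State}
    (hq : q.1 = ⟦χ⟧) : q ∈ (mojmir ψ 𝒢).F ↔
      ∀ v : LTL Ap → Prop, (∀ θ, glob θ ∈ 𝒢 → v (glob θ)) → Holds v χ := by
  change (∀ v : LTL Ap → Prop, (∀ θ, glob θ ∈ 𝒢 → v (glob θ)) → PropClass.Holds v q.1) ↔ _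
  rw [hq]
  rfl

/-- A token succeeds if and only if the formula on which it starts holds, with `𝒢` as the set of
the true `G`-formulae. -/
theorem not_failing_iff {ψ χ : LTL Ap} {𝒢 : Set (LTL Ap)} {w : ℕ → Set Ap} {t : ℕ}
    {q : (slaveSys ψ).State} (hq : q.1 = ⟦χ⟧) :
    ¬ (mojmir ψ 𝒢).Failing w t q ↔ SatG 𝒢 (wordSuffix w t) χ := by
  unfold Mojmir.Failing
  push Not
  constructor
  · rintro ⟨n, hn⟩
    rw [← satG_unfold 𝒢 w χ t n, ← holds_satG]
    -- The relative semantics of the remaining word is one of the valuations that make `𝒢` true.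
    exact (mem_mojmir_F (slaveSys_runFrom ψ w hq t n)).1 hn _ fun θ hθ => hθ
  · intro h
    obtain ⟨n, hn⟩ := h.exists_holds_unfold
    exact ⟨n, (mem_mojmir_F (slaveSys_runFrom ψ w hq t n)).2 (hn n le_rfl)⟩

/-! ### Semantics and guesses of the true `G`-formulae -/

/-- If, for the formulae `G ψ` in `𝒢`, almost all suffixes satisfy `ψ` relative to `𝒢`, then
eventually truth relative to `𝒢` implies truth. -/
theorem exists_sat_of_satG {𝒢 : Set (LTL Ap)} {w : ℕ → Set Ap}
    (h : ∀ ψ, glob ψ ∈ 𝒢 → ∃ N, ∀ m ≥ N, SatG 𝒢 (wordSuffix w m) ψ) (θ : LTL Ap) :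
    ∃ N, ∀ m ≥ N, SatG 𝒢 (wordSuffix w m) θ → Sat (wordSuffix w m) θ := by
  induction θ with
  | tt => exact ⟨0, fun m _ h => h⟩
  | ff => exact ⟨0, fun m _ h => h⟩
  | atom a => exact ⟨0, fun m _ h => h⟩
  | natom a => exact ⟨0, fun m _ h => h⟩
  | and φ ψ ih₁ ih₂ =>
    obtain ⟨N₁, h₁⟩ := ih₁
    obtain ⟨N₂, h₂⟩ := ih₂
    exact ⟨max N₁ N₂, fun m hm => And.imp (h₁ m (le_of_max_le_left hm))
      (h₂ m (le_of_max_le_right hm))⟩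
  | or φ ψ ih₁ ih₂ =>
    obtain ⟨N₁, h₁⟩ := ih₁
    obtain ⟨N₂, h₂⟩ := ih₂
    exact ⟨max N₁ N₂, fun m hm => Or.imp (h₁ m (le_of_max_le_left hm))
      (h₂ m (le_of_max_le_right hm))⟩
  | next φ ih =>
    obtain ⟨N₁, h₁⟩ := ih
    refine ⟨N₁, fun m hm => ?_⟩
    simp only [SatG, Sat, wordSuffix_wordSuffix]
    exact h₁ _ (by omega)
  | fin φ ih =>
    obtain ⟨N₁, h₁⟩ := ih
    refine ⟨N₁, fun m hm => ?_⟩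
    simp only [SatG, Sat, wordSuffix_wordSuffix]
    exact fun ⟨k, hk⟩ => ⟨k, h₁ _ (by omega) hk⟩
  | glob φ ih =>
    by_cases hφ : glob φ ∈ 𝒢
    -- Past both thresholds every later suffix satisfies `φ` relative to `𝒢`, hence truly, so `G φ`
    -- is true whatever the guess said.
    · obtain ⟨N₁, h₁⟩ := ih
      obtain ⟨N₂, h₂⟩ := h φ hφ
      refine ⟨max N₁ N₂, fun m hm _ => ?_⟩
      simp only [Sat, wordSuffix_wordSuffix]
      exact fun k => h₁ _ (by omega) (h₂ _ (by omega))
    · exact ⟨0, fun m _ h => absurd h hφ⟩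
  | untl φ ψ ih₁ ih₂ =>
    obtain ⟨N₁, h₁⟩ := ih₁
    obtain ⟨N₂, h₂⟩ := ih₂
    refine ⟨max N₁ N₂, fun m hm => ?_⟩
    simp only [SatG, Sat, wordSuffix_wordSuffix]
    exact fun ⟨k, hk, hj⟩ => ⟨k, h₂ _ (by omega) hk, fun j hjk => h₁ _ (by omega) (hj j hjk)⟩

/-- The formulae `G ψ` in `gSubformulas φ` with `w ⊨ F G ψ`. -/
def trueG (φ : LTL Ap) (w : ℕ → Set Ap) : Set (LTL Ap) :=
  {χ ∈ gSubformulas φ | ∃ N, Sat (wordSuffix w N) χ}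

/-- Formulae are in negation normal form, so it suffices to compare the `G`-subformulae: one that is
true on the suffix from `m` is in `trueG` with witness `m`. -/
theorem satG_trueG_of_sat {φ : LTL Ap} {w : ℕ → Set Ap} {θ : LTL Ap} (hθ : GSub φ θ) :
    ∀ {m}, Sat (wordSuffix w m) θ → SatG (trueG φ w) (wordSuffix w m) θ := by
  induction θ with
  | tt => exact fun h => h
  | ff => exact fun h => h
  | atom a => exact fun h => h
  | natom a => exact fun h => h
  | and φ ψ ih₁ ih₂ =>
    exact fun h => ⟨ih₁ (hθ.mono (Or.inr (Or.inl (self_mem_subformulas _)))) h.1,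
      ih₂ (hθ.mono (Or.inr (Or.inr (self_mem_subformulas _)))) h.2⟩
  | or φ ψ ih₁ ih₂ =>
    exact fun h => h.imp (ih₁ (hθ.mono (Or.inr (Or.inl (self_mem_subformulas _)))))
      (ih₂ (hθ.mono (Or.inr (Or.inr (self_mem_subformulas _)))))
  | next φ ih =>
    intro m
    simp only [SatG, Sat, wordSuffix_wordSuffix]
    exact ih (hθ.mono (Or.inr (self_mem_subformulas _)))
  | fin φ ih =>
    intro m
    simp only [SatG, Sat, wordSuffix_wordSuffix]
    exact fun ⟨k, hk⟩ => ⟨k, ih (hθ.mono (Or.inr (self_mem_subformulas _))) hk⟩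
  | glob φ ih => exact fun {m} h => ⟨hθ _ (self_mem_subformulas _), m, h⟩
  | untl φ ψ ih₁ ih₂ =>
    intro m
    simp only [SatG, Sat, wordSuffix_wordSuffix]
    exact fun ⟨k, hk, hj⟩ => ⟨k, ih₂ (hθ.mono (Or.inr (Or.inr (self_mem_subformulas _)))) hk,
      fun j hjk => ih₁ (hθ.mono (Or.inr (Or.inl (self_mem_subformulas _)))) (hj j hjk)⟩

theorem satG_of_glob_mem_trueG {φ ψ : LTL Ap} {w : ℕ → Set Ap} (h : glob ψ ∈ trueG φ w) :
    ∃ N, ∀ m ≥ N, SatG (trueG φ w) (wordSuffix w m) ψ := by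
  obtain ⟨hψ, N, hN⟩ := h
  refine ⟨N, fun m hm => satG_trueG_of_sat ?_ ?_⟩
  · exact (gSub_self φ).mono (subformulas_trans hψ.1 (Or.inr (self_mem_subformulas _)))
  · have := hN (m - N)
    rwa [wordSuffix_wordSuffix, Nat.add_sub_cancel' hm] at this

/-! ### The acceptance condition -/

theorem slavePair_accepts_iff {φ : LTL Ap} {𝒢 : Set (LTL Ap)} {ψ : GIndex φ} {j : ℕ}
    {w : ℕ → Set Ap} : (slavePair φ 𝒢 ψ j).Accepts ((productSys φ).runTrans w) ↔
      ((mojmir ψ.1 𝒢).toDRA.pair j).Accepts ((mojmir ψ.1 𝒢).toDRA.runTrans w) := by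
  have h : ∀ n, (((productSys φ).runTrans w n).1.2 ψ, ((productSys φ).runTrans w n).2.1,
      ((productSys φ).runTrans w n).2.2.2 ψ) = (mojmir ψ.1 𝒢).toDRA.runTrans w n := by
    intro n
    simp only [TransSys.runTrans, productSys_run_snd]
    rfl
  simp only [RabinPair.Accepts, slavePair, Set.mem_ofPred_eq, h]
  rfl

theorem masterPair_accepts_iff {φ : LTL Ap} {𝒢 : Set (LTL Ap)} {π : GIndex φ → ℕ}
    {w : ℕ → Set Ap} : (masterPair φ 𝒢 π).Accepts ((productSys φ).runTrans w) ↔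
      ∃ N, ∀ t ≥ N, (productSys φ).run w t ∈ goodStates φ 𝒢 π := by
  constructor
  · rintro ⟨h, -⟩
    obtain ⟨N, hN⟩ := h.exists_forall_ge_notMem
    exact ⟨N, fun t ht => not_not.1 (hN t ht)⟩
  · rintro ⟨N, hN⟩
    refine ⟨(Set.finite_Iio N).subset fun t ht => ?_, ?_⟩
    · by_contra! hge
      exact ht (hN t (by simpa using hge))
    · simpa [masterPair] using Set.infinite_univ

theorem run_mem_goodStates_iff {φ : LTL Ap} {𝒢 : Set (LTL Ap)} {π : GIndex φ → ℕ}
    {w : ℕ → Set Ap} {t : ℕ} : (productSys φ).run w t ∈ goodStates φ 𝒢 π ↔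
      ∀ v : LTL Ap → Prop,
        (∀ ψ : GIndex φ, glob ψ.1 ∈ 𝒢 →
          v (glob ψ.1) ∧ ∀ (q : (slaveSys ψ.1).State) (k : ℕ),
            ((slaveSys ψ.1).rankings.run w t).rk q = some k → π ψ ≤ k →
              PropClass.Holds v q.1) →
        (∀ ψ : GIndex φ, glob ψ.1 ∉ 𝒢 → ¬ v (glob ψ.1)) →
        Holds v (unfold af w φ 0 t) := by
  simp only [goodStates, Set.mem_ofPred_eq, productSys_run_snd, productSys_run_fst, master_run]
  rfl

theorem exists_forall_ge_of_finite {ι : Type*} [Finite ι] {P : ι → ℕ → Prop}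
    (h : ∀ i, ∃ N, ∀ n ≥ N, P i n) : ∃ N, ∀ n ≥ N, ∀ i, P i n := by
  have : ∀ᶠ n in Filter.atTop, ∀ i, P i n :=
    Filter.eventually_all.2 fun i => Filter.eventually_atTop.2 (h i)
  exact Filter.eventually_atTop.1 this

/-! ### The two inclusions -/

theorem automaton_language_subset (φ : LTL Ap) : (automaton φ).language ⊆ φ.language := by
  rintro w ⟨_, ⟨𝒢, π, h𝒢, -, rfl⟩, hacc⟩
  have := finite_GIndex φ
  obtain ⟨N₁, hgood⟩ := masterPair_accepts_iff.1 (hacc _ (Or.inl rfl))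
  have hslave : ∀ ψ : GIndex φ, ∃ N, ∀ t ≥ N, glob ψ.1 ∈ 𝒢 →
      ¬ (mojmir ψ.1 𝒢).Failing w t (mojmir ψ.1 𝒢).init ∧
      ∀ q k, ((mojmir ψ.1 𝒢).rankings.run w t).rk q = some k → π ψ ≤ k →
        ¬ (mojmir ψ.1 𝒢).Failing w t q := by
    intro ψ
    by_cases hψ : glob ψ.1 ∈ 𝒢
    · obtain ⟨N, hN⟩ := (mojmir ψ.1 𝒢).not_failing_of_accepts w
        (slavePair_accepts_iff.1 (hacc _ (Or.inr ⟨ψ, hψ, rfl⟩)))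
      exact ⟨N, fun t ht _ => hN t ht⟩
    · exact ⟨0, fun t _ h => absurd h hψ⟩
  obtain ⟨N₂, hN₂⟩ := exists_forall_ge_of_finite hslave
  have hsat : ∀ θ, ∃ N, ∀ m ≥ N, SatG 𝒢 (wordSuffix w m) θ → Sat (wordSuffix w m) θ :=
    exists_sat_of_satG fun ψ hψ =>
      ⟨N₂, fun m hm => (not_failing_iff rfl).1 (hN₂ m hm ⟨ψ, h𝒢 hψ⟩ hψ).1⟩
  -- truth relative to `𝒢` only has to imply truth for the finitely many master states
  have := (master φ).finite
  have hmaster : ∀ c : (master φ).State, ∃ N, ∀ m ≥ N,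
      PropClass.Holds (SatG 𝒢 (wordSuffix w m)) c.1 →
        PropClass.Holds (Sat (wordSuffix w m)) c.1 := by
    intro c
    obtain ⟨θ, hθ⟩ := Quotient.exists_rep c.1
    obtain ⟨N, hN⟩ := hsat θ
    refine ⟨N, fun m hm h => ?_⟩
    rw [← hθ] at h ⊢
    exact (holds_sat _ _).2 (hN m hm ((holds_satG _ _ _).1 h))
  -- The threshold must not depend on the master state, because that state is read off at a time
  -- chosen after the threshold.
  obtain ⟨N₃, hN₃⟩ := exists_forall_ge_of_finite hmaster
  have ht₁ : N₁ ≤ N₁ + N₂ + N₃ := by omega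
  have ht₂ : N₂ ≤ N₁ + N₂ + N₃ := by omega
  have ht₃ : N₃ ≤ N₁ + N₂ + N₃ := by omega
  generalize N₁ + N₂ + N₃ = t at ht₁ ht₂ ht₃
  -- Relative truth makes exactly the guessed `G`-formulae true, and the formulae of rank at least
  -- `π ψ` as well, since their tokens succeed.
  have hh := run_mem_goodStates_iff.1 (hgood t ht₁) (SatG 𝒢 (wordSuffix w t))
    (fun ψ hψ => ⟨hψ, fun q k hq hk => ?_⟩) fun ψ hψ => hψ
  · have h := hN₃ t ht₃ ((master φ).run w t)
    rw [master_run] at h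
    exact (sat_unfold w φ t).1 ((holds_sat _ _).1 (h hh))
  · obtain ⟨χ, hχ⟩ := Quotient.exists_rep q.1
    have h := (not_failing_iff hχ.symm).1 ((hN₂ t ht₂ ψ hψ).2 q k hq hk)
    rw [← hχ]
    exact (holds_satG _ _ _).2 h

theorem subset_automaton_language (φ : LTL Ap) : φ.language ⊆ (automaton φ).language := by
  intro w hw
  have := finite_GIndex φ
  let 𝒢 := trueG φ w
  have hslave : ∀ ψ : GIndex φ, ∃ j, glob ψ.1 ∈ 𝒢 →
      1 ≤ j ∧ j ≤ (slave ψ.1 𝒢).numPairs ∧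
      ((mojmir ψ.1 𝒢).toDRA.pair j).Accepts ((mojmir ψ.1 𝒢).toDRA.runTrans w) ∧
      ∃ T, ∀ t ≥ T, ∀ q k, ((mojmir ψ.1 𝒢).rankings.run w t).rk q = some k → k < j →
        q ∉ (mojmir ψ.1 𝒢).F → (mojmir ψ.1 𝒢).Failing w t q := by
    intro ψ
    by_cases hψ : glob ψ.1 ∈ 𝒢
    · obtain ⟨N, hN⟩ := satG_of_glob_mem_trueG hψ
      obtain ⟨j, hj⟩ := (mojmir ψ.1 𝒢).exists_accepts w (N := N)
        fun t ht => (not_failing_iff rfl).2 (hN t ht)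
      exact ⟨j, fun _ => hj⟩
    · exact ⟨0, fun h => absurd h hψ⟩
  choose π hπ using hslave
  refine ⟨_, ⟨𝒢, π, fun χ hχ => hχ.1, fun ψ hψ => ⟨(hπ ψ hψ).1, (hπ ψ hψ).2.1⟩, rfl⟩, ?_⟩
  rintro P (rfl | ⟨ψ, hψ, rfl⟩)
  swap
  · exact slavePair_accepts_iff.2 (hπ ψ hψ).2.2.1
  refine masterPair_accepts_iff.2 ?_
  have hN : ∀ ψ : GIndex φ, ∃ N, ∀ m ≥ N, glob ψ.1 ∈ 𝒢 → SatG 𝒢 (wordSuffix w m) ψ.1 := by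
    intro ψ
    by_cases hψ : glob ψ.1 ∈ 𝒢
    · obtain ⟨N, hN⟩ := satG_of_glob_mem_trueG hψ
      exact ⟨N, fun m hm _ => hN m hm⟩
    · exact ⟨0, fun m _ h => absurd h hψ⟩
  obtain ⟨N, hN⟩ := exists_forall_ge_of_finite hN
  have hT : ∀ ψ : GIndex φ, ∃ T, ∀ t ≥ T, glob ψ.1 ∈ 𝒢 → ∀ q k,
      ((mojmir ψ.1 𝒢).rankings.run w t).rk q = some k → k < π ψ →
        q ∉ (mojmir ψ.1 𝒢).F → (mojmir ψ.1 𝒢).Failing w t q := by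
    intro ψ
    by_cases hψ : glob ψ.1 ∈ 𝒢
    · obtain ⟨T, hT⟩ := (hπ ψ hψ).2.2.2
      exact ⟨T, fun t ht _ => hT t ht⟩
    · exact ⟨0, fun m _ h => absurd h hψ⟩
  obtain ⟨T, hT⟩ := exists_forall_ge_of_finite hT
  -- Up to `N` the exact unfolding by `af` is kept; only copies of `ψ` spawned from `N` on, which
  -- all hold relative to `𝒢`, are left to the slaves.
  have hsatN : SatG 𝒢 (wordSuffix w N) (unfold af w φ 0 N) :=
    satG_trueG_of_sat ((gSub_self φ).unfold w 0 N) ((sat_unfold w φ N).2 hw)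
  obtain ⟨n₀, hn₀⟩ := hsatN.exists_holds_unfold
  refine ⟨max T (N + n₀), fun t ht => run_mem_goodStates_iff.2 fun v hv hv' => ?_⟩
  have hvG : ∀ ψ, glob ψ ∈ 𝒢 → v (glob ψ) := fun ψ hψ => (hv ⟨ψ, hψ.1⟩ hψ).1
  obtain ⟨n, rfl⟩ := Nat.exists_eq_add_of_le ((Nat.le_add_right N n₀).trans (le_of_max_le_right ht))
  rw [unfold_add, Nat.zero_add]
  refine holds_unfold_af (φ := φ) (N := N) (t := N + n) ?_ ((gSub_self φ).unfold w 0 N) le_rfl rfl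
    (hn₀ n (by omega) v hvG)
  intro ψ hψ hvψ m l hm hl
  -- Here the conjuncts `¬ G ψ` of the master condition are needed: `v` makes no `G`-subformula
  -- outside `𝒢` true.
  have hψ𝒢 : glob ψ ∈ 𝒢 := by
    by_contra h
    exact hv' ⟨ψ, hψ⟩ h hvψ
  have hst := slaveSys_runFrom ψ w (q := (slaveSys ψ).init) rfl m l
  have hnf : ¬ (mojmir ψ 𝒢).Failing w (m + l) ((slaveSys ψ).runFrom w (slaveSys ψ).init m l) :=
    (not_failing_iff hst).2 ((satG_unfold 𝒢 w ψ m l).2 (hN m hm ⟨ψ, hψ⟩ hψ𝒢))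
  have hF : (slaveSys ψ).runFrom w (slaveSys ψ).init m l ∈ (mojmir ψ 𝒢).F →
      Holds v (unfold afG w ψ m l) := fun h => (mem_mojmir_F hst).1 h v hvG
  -- The token born at `m` succeeds. In a sink, or with rank below `π ψ`, it must already be
  -- accepting, so `𝒢` implies its formula; with a younger rank its formula is among the assumptions
  -- on `v`.
  rcases (slaveSys ψ).exists_rk_runFrom_init w m l with hs | ⟨k, hk⟩
  · exact hF (by_contra fun h => hnf (Mojmir.failing_of_isSink hs h))
  · rw [hl] at hk hnf
    rcases lt_or_ge k (π ⟨ψ, hψ⟩) with hlt | hge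
    · exact hF (by_contra fun h =>
        hnf (hT (N + n) (le_of_max_le_left ht) ⟨ψ, hψ⟩ hψ𝒢 _ k hk hlt h))
    · have h := (hv ⟨ψ, hψ⟩ hψ𝒢).2 _ k hk hge
      rw [hst] at h
      exact h

end LTL

theorem mainTheorem1 {Ap : Type*} [Finite Ap] (φ : LTL Ap) :
    (LTL.automaton φ).language = φ.language :=
  (LTL.automaton_language_subset φ).antisymm (LTL.subset_automaton_language φ)
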